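/- Let $k,N,n$ be positive integers. A set $B$ contains a $k$-term arithmetic progression (AP) with common difference $d$ if $a+d,a+2d,\dots,a+kd\in B$ for some $a$ in the ambient group; $d=0$ is allowed. For $E\subseteq\mathbb R^n$ let $N_E(\epsilon)$ be the smallest positive integer $m$ such that $E$ is covered by $m$ axis-parallel boxes of side lengths at most $\epsilon$ ($N_E(\epsilon)=\infty$ if there is none), and put \[\dim_M E=\limsup_{\epsilon\to0^+}\frac{\log N_E(\epsilon)}{\log(1/\epsilon)},\qquad \dim_P E=\inf\Big\{\sup_{j}\dim_M E_j : E\subseteq\bigcup_{j\in\mathbb N}E_j\Big\}.\] Let $f_n^M(k)$ and $f_n^P(k)$ be the infima of $\dim_M B$ and of $\dim_P B$, respectively, over all sets $B\subseteq\mathbb R^n$ that contain a $k$-term AP with every common difference $d\in[0,1]^n$. Let $F'_{n,k}(N)$ be the least cardinality of a set in $\mathbb R^n$ that contains a $k$-term AP with common difference $d$ for $N^n$ distinct values of $d\in\mathbb N^n$ (where $0\in\mathbb N$). Let $F'_k(N)$ be the least cardinality of a set of integers that contains a $k$-term AP with common difference $d$ for $N$ distinct values of $d\in\mathbb Z$,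 and $F_k(N)$ the least cardinality of a set of integers that contains a $k$-term AP with common difference $d$ for each $d\in\{1,\dots,N\}$. Theorem. (1) For all $n,k\ge1$ the limit $\lim_{N\to\infty}\log F'_{n,k}(N)/\log N$ exists, is finite, and \[f_n^P(k)=f_n^M(k)=\lim_{N\to\infty}\frac{\log F'_{n,k}(N)}{\log N}.\] (2) For all $k\ge1$ the limit $\lim_{N\to\infty}\log F'_{k}(N)/\log N$ exists, is finite, and \[f_1^P(k)=f_1^M(k)=\lim_{N\to\infty}\frac{\log F'_{k}(N)}{\log N}.\] (3) For every $n\ge1$ the following are equivalent (an iterated limit is understood to include the existence of the inner limit for every $k\ge1$): - (arithmetic Kakeya conjecture, first form) $\lim_{k\to\infty}\lim_{N\to\infty}\log F_k(N)/\log N=1$; - (arithmetic Kakeya conjecture, second form) $\lim_{k\to\infty}\lim_{N\to\infty}\log F'_k(N)/\log N=1$; - ($n$-dimensional arithmetic Kakeya conjecture) $\lim_{k\to\infty}\lim_{N\to\infty}\log F'_{n,k}(N)/\log N=n$; - ($n$-dimensional Minkowski arithmetic Kakeya conjecture) $\lim_{k\to\infty}f_n^M(k)=n$; - ($n$-dimensional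 packing arithmetic Kakeya conjecture) $\lim_{k\to\infty}f_n^P(k)=n$. Since the first two do not involve $n$, the last three conjectures, for all $n\ge1$ together, are all equivalent to each other. -/

import Mathlib

open Filter Topology

noncomputable section

/-- `B` contains the `k`-term arithmetic progression `a + d, a + 2d, …, a + kd` for some `a`. -/
def ContainsAP {M : Type*} [AddCommMonoid M] (B : Set M) (k : ℕ) (d : M) : Prop :=
  ∃ a : M, ∀ i : ℕ, 1 ≤ i → i ≤ k → a + i • d ∈ B

/-- `E ⊆ ℝⁿ` is covered by `m` axis-parallel closed boxes, all of whose side lengths are at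
most `ε`. -/
def CoveredByBoxes {n : ℕ} (E : Set (Fin n → ℝ)) (ε : ℝ) (m : ℕ) : Prop :=
  ∃ a b : Fin m → Fin n → ℝ,
    (∀ j i, a j i ≤ b j i ∧ b j i - a j i ≤ ε) ∧ E ⊆ ⋃ j, Set.Icc (a j) (b j)

/-- The smallest positive integer `m` such that `E` is covered by `m` boxes of side length at
most `ε`; it is `⊤` if there is no such `m`. -/
def boxNumber {n : ℕ} (E : Set (Fin n → ℝ)) (ε : ℝ) : ℕ∞ :=
  ⨅ (m : ℕ) (_ : 0 < m ∧ CoveredByBoxes E ε m), (m : ℕ∞)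

/-- (Upper) Minkowski dimension, i.e. upper box dimension. It is `⊤` for unbounded sets. -/
def minkowskiDim {n : ℕ} (E : Set (Fin n → ℝ)) : EReal :=
  limsup (fun ε : ℝ => ENNReal.log (boxNumber E ε : ENNReal) / ((Real.log (1 / ε) : ℝ) : EReal))
    (𝓝[>] 0)

/-- Packing dimension, i.e. modified upper box dimension. -/
def packingDim {n : ℕ} (E : Set (Fin n → ℝ)) : EReal :=
  ⨅ (S : ℕ → Set (Fin n → ℝ)) (_ : E ⊆ ⋃ j, S j), ⨆ j, minkowskiDim (S j)

/-- `B ⊆ ℝⁿ` contains a `k`-term arithmetic progression with every common difference in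
`[0,1]ⁿ`. -/
def ContainsAllAPs {n : ℕ} (B : Set (Fin n → ℝ)) (k : ℕ) : Prop :=
  ∀ d ∈ Set.Icc (0 : Fin n → ℝ) 1, ContainsAP B k d

/-- The infimum of the Minkowski dimensions of the subsets of `ℝⁿ` that contain a `k`-term
arithmetic progression with every common difference in `[0,1]ⁿ`. -/
def minkowskiAP (n k : ℕ) : EReal :=
  ⨅ (B : Set (Fin n → ℝ)) (_ : ContainsAllAPs B k), minkowskiDim B

/-- The infimum of the packing dimensions of the subsets of `ℝⁿ` that contain a `k`-term
arithmetic progression with every common difference in `[0,1]ⁿ`. -/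
def packingAP (n k : ℕ) : EReal :=
  ⨅ (B : Set (Fin n → ℝ)) (_ : ContainsAllAPs B k), packingDim B

/-- `F'_{n,k}(N)`: the least cardinality of a subset of `ℝⁿ` that contains a `k`-term arithmetic
progression with common difference `d` for `Nⁿ` distinct values of `d ∈ ℕⁿ`. -/
def minCardAPDim (n k N : ℕ) : ℕ :=
  sInf {c : ℕ | ∃ (A : Finset (Fin n → ℝ)) (D : Finset (Fin n → ℕ)),
    A.card = c ∧ D.card = N ^ n ∧
      ∀ d ∈ D, ContainsAP (A : Set (Fin n → ℝ)) k (fun i => (d i : ℝ))}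

/-- `F'_k(N)`: the least cardinality of a set of integers that contains a `k`-term arithmetic
progression with common difference `d` for `N` distinct values of `d ∈ ℤ`. -/
def minCardAPDistinct (k N : ℕ) : ℕ :=
  sInf {c : ℕ | ∃ A D : Finset ℤ,
    A.card = c ∧ D.card = N ∧ ∀ d ∈ D, ContainsAP (A : Set ℤ) k d}

/-- `F_k(N)`: the least cardinality of a set of integers that contains a `k`-term arithmetic
progression with common difference `d` for each `d ∈ {1, …, N}`. -/
def minCardAPInitial (k N : ℕ) : ℕ :=
  sInf {c : ℕ | ∃ A : Finset ℤ,
    A.card = c ∧ ∀ d ∈ Finset.Icc (1 : ℤ) N, ContainsAP (A : Set ℤ) k d}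

/-- `lim_{k → ∞} lim_{N → ∞} log F(k,N) / log N = a`, where the inner limit exists for every
`k ≥ 1`. -/
def IteratedExponentLimit (F : ℕ → ℕ → ℕ) (a : ℝ) : Prop :=
  ∃ L : ℕ → ℝ,
    (∀ k : ℕ, 1 ≤ k →
      Tendsto (fun N : ℕ => Real.log (F k N) / Real.log N) atTop (𝓝 (L k))) ∧
    Tendsto L atTop (𝓝 a)

/-- The arithmetic Kakeya conjecture, with every common difference in `{1, …, N}`. -/
def ArithmeticKakeyaInitial : Prop := IteratedExponentLimit minCardAPInitial 1

/-- The arithmetic Kakeya conjecture, with `N` distinct common differences. -/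
def ArithmeticKakeyaDistinct : Prop := IteratedExponentLimit minCardAPDistinct 1

/-- The `n`-dimensional arithmetic Kakeya conjecture. -/
def ArithmeticKakeyaDim (n : ℕ) : Prop := IteratedExponentLimit (minCardAPDim n) n

/-- The `n`-dimensional Minkowski arithmetic Kakeya conjecture. -/
def MinkowskiArithmeticKakeya (n : ℕ) : Prop :=
  Tendsto (fun k : ℕ => minkowskiAP n k) atTop (𝓝 (n : EReal))

/-- The `n`-dimensional packing arithmetic Kakeya conjecture. -/
def PackingArithmeticKakeya (n : ℕ) : Prop :=
  Tendsto (fun k : ℕ => packingAP n k) atTop (𝓝 (n : EReal))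

end

/-! Everything is governed by one number, the growth exponent $\alpha_k$ of $F_k(N)$. Splitting $d$
into its remainder and quotient by $N$ gives $F_k(NM)\le F_k(N)F_k(M)$, so $\alpha_k$ exists by
Fekete's lemma, and moreover $N^{\alpha_k}\le F_k(N)$ for every $N\ge1$. The limits for $F'_k$ and
$F'_{n,k}$ and the values of $f_n^M(k)$ and $f_n^P(k)$ are then $\alpha_k$, $n\alpha_k$, $n\alpha_k$
and $n\alpha_k$, which makes every conjecture equivalent to $\alpha_k\to1$.

The combinatorial core is `minCardAPInitial_card_le`: if a finite $A$ serves $P$ arbitrary integer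
differences, then $F_k(P)\le C_k(1+\log P)|A|$. A suitable dilation followed by rounding modulo $P$
keeps at least $P/4$ of the differences distinct, $O(1+\log P)$ translates of these residues fill
$\mathbb Z/P$, and the result is lifted to $\mathbb Z$. A linear map that is injective on the
differences reduces $\mathbb R^n$ to this case. Product sets give the opposite bound.

For the dimensions, reals whose base-$b$ digits come from an extremal integer set contain all the
progressions, since the construction works digit by digit; this bounds $f_n^M$ above. For the lower
bound on $f_n^P$, finitely many pieces of a countable cover already serve a set of differences of
positive outer volume. Rounding at scale $1/N$ then turns a dimension bound into a finite
configuration to which the core applies (`mul_exponent_le_of_cover`). -/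

/-! ### The growth exponent of $F_k$ -/

theorem minCardAPInitial_le {k N : ℕ} {A : Finset ℤ}
    (hA : ∀ d ∈ Finset.Icc (1 : ℤ) N, ContainsAP (A : Set ℤ) k d) :
    minCardAPInitial k N ≤ A.card :=
  Nat.sInf_le ⟨A, rfl, hA⟩

theorem exists_card_eq_minCardAPInitial (k N : ℕ) :
    ∃ A : Finset ℤ, A.card = minCardAPInitial k N ∧
      ∀ d ∈ Finset.Icc (1 : ℤ) N, ContainsAP (A : Set ℤ) k d := by
  refine Nat.sInf_mem (s := {c : ℕ | ∃ A : Finset ℤ,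
    A.card = c ∧ ∀ d ∈ Finset.Icc (1 : ℤ) N, ContainsAP (A : Set ℤ) k d})
    ⟨_, Finset.Icc 0 ((k : ℤ) * N), rfl, fun d hd => ⟨0, fun i _ hi => ?_⟩⟩
  rw [Finset.mem_Icc] at hd
  have hi' : (i : ℤ) ≤ k := by exact_mod_cast hi
  simp only [Finset.coe_Icc, Set.mem_Icc, zero_add, nsmul_eq_mul]
  constructor
  · exact mul_nonneg (by positivity) (by linarith)
  · exact mul_le_mul hi' hd.2 (by linarith) (by positivity)

theorem containsAP_zero {M : Type*} [AddCommMonoid M] {B : Set M} (k : ℕ) (hB : B.Nonempty) :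
    ContainsAP B k 0 := by
  obtain ⟨b, hb⟩ := hB
  exact ⟨b, fun i _ _ => by simpa using hb⟩

theorem ContainsAP.nonempty {M : Type*} [AddCommMonoid M] {B : Set M} {k : ℕ} {d : M}
    (h : ContainsAP B k d) (hk : 1 ≤ k) : B.Nonempty := by
  obtain ⟨a, ha⟩ := h
  exact ⟨_, ha 1 le_rfl hk⟩

/-- Common difference `0` comes for free. -/
theorem exists_finset_containsAP_le {k N : ℕ} (hk : 1 ≤ k) (hN : 1 ≤ N) :
    ∃ A : Finset ℤ, A.card = minCardAPInitial k N ∧ A.Nonempty ∧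
      ∀ d : ℕ, d ≤ N → ContainsAP (A : Set ℤ) k d := by
  obtain ⟨A, hA, h⟩ := exists_card_eq_minCardAPInitial k N
  have hne : (A : Set ℤ).Nonempty :=
    (h 1 (by simp only [Finset.mem_Icc]; omega)).nonempty hk
  refine ⟨A, hA, by simpa using hne, fun d hd => ?_⟩
  rcases Nat.eq_zero_or_pos d with rfl | hd0
  · simpa using containsAP_zero k hne
  · exact h d (by simp only [Finset.mem_Icc]; omega)

theorem one_le_minCardAPInitial {k N : ℕ} (hk : 1 ≤ k) (hN : 1 ≤ N) :
    1 ≤ minCardAPInitial k N := by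
  obtain ⟨A, hA, hne, -⟩ := exists_finset_containsAP_le hk hN
  rw [← hA]
  exact hne.card_pos

theorem minCardAPInitial_mono (k : ℕ) : Monotone (minCardAPInitial k) := by
  intro N M hNM
  obtain ⟨A, hA, h⟩ := exists_card_eq_minCardAPInitial k M
  rw [← hA]
  refine minCardAPInitial_le fun d hd => h d ?_
  simp only [Finset.mem_Icc] at hd ⊢
  omega

/-- Write $d=r+Nq$ with $0\le r<N$ and $q\le M$; progressions with differences $r$ and $q$ combine
in $A+N\cdot B$. Both $r$ and $q$ may vanish, hence the need for difference $0$. -/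
theorem minCardAPInitial_mul_le {k N M : ℕ} (hk : 1 ≤ k) (hN : 1 ≤ N) (hM : 1 ≤ M) :
    minCardAPInitial k (N * M) ≤ minCardAPInitial k N * minCardAPInitial k M := by
  obtain ⟨A, hA, -, hA'⟩ := exists_finset_containsAP_le hk hN
  obtain ⟨B, hB, -, hB'⟩ := exists_finset_containsAP_le hk hM
  rw [← hA, ← hB]
  refine le_trans (minCardAPInitial_le
    (A := Finset.image₂ (fun a b : ℤ => a + N * b) A B) fun d hd => ?_) (Finset.card_image₂_le _ _ _)
  simp only [Finset.mem_Icc] at hd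
  lift d to ℕ using by omega
  obtain ⟨a, ha⟩ := hA' (d % N) (Nat.mod_lt _ hN).le
  obtain ⟨b, hb⟩ := hB' (d / N) (Nat.div_le_of_le_mul (by exact_mod_cast hd.2))
  refine ⟨a + N * b, fun i h1 h2 => ?_⟩
  rw [Finset.coe_image₂]
  refine ⟨_, ha i h1 h2, _, hb i h1 h2, ?_⟩
  have h3 : ((d : ℕ) : ℤ) = ((d % N : ℕ) : ℤ) + N * ((d / N : ℕ) : ℤ) := by
    exact_mod_cast (Nat.mod_add_div d N).symm
  simp only [nsmul_eq_mul]
  rw [h3]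
  ring

theorem minCardAPInitial_pow_le {k N : ℕ} (hk : 1 ≤ k) (hN : 1 ≤ N) (m : ℕ) :
    minCardAPInitial k (N ^ (m + 1)) ≤ minCardAPInitial k N ^ (m + 1) := by
  induction m with
  | zero => simp
  | succ m ih =>
    rw [pow_succ N, pow_succ (minCardAPInitial k N)]
    exact (minCardAPInitial_mul_le hk (Nat.one_le_pow _ _ hN) hN).trans
      (Nat.mul_le_mul_right _ ih)

theorem tendsto_natLog_two_atTop : Tendsto (Nat.log 2) atTop atTop :=
  tendsto_atTop_atTop.2 fun b => ⟨2 ^ b, fun a ha => by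
    simpa using Nat.log_mono_right (b := 2) ha⟩

/-- A monotone, positive, submultiplicative sequence has a growth exponent. -/
theorem exists_tendsto_log_div_log_of_submultiplicative {F : ℕ → ℕ} (hmono : Monotone F)
    (hpos : ∀ N, 1 ≤ N → 1 ≤ F N)
    (hmul : ∀ N M, 1 ≤ N → 1 ≤ M → F (N * M) ≤ F N * F M) :
    ∃ α : ℝ, Tendsto (fun N : ℕ => Real.log (F N) / Real.log N) atTop (𝓝 α) := by
  have hpos' : ∀ m : ℕ, (1 : ℝ) ≤ F (2 ^ m) := fun m => by
    exact_mod_cast hpos _ Nat.one_le_two_pow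
  -- Fekete's lemma gives the limit along powers of $2$; monotonicity interpolates between $2^m\le
  -- N\le 2^{m+1}$.
  have hsub : Subadditive fun m : ℕ => Real.log (F (2 ^ m)) := by
    intro m n
    have h1 := hpos' m
    have h2 := hpos' n
    rw [← Real.log_mul (by positivity) (by positivity)]
    refine Real.log_le_log (by linarith [hpos' (m + n)]) ?_
    rw [pow_add]
    exact_mod_cast hmul _ _ Nat.one_le_two_pow Nat.one_le_two_pow
  have hbdd : BddBelow (Set.range fun n : ℕ => Real.log (F (2 ^ n)) / n) := by
    refine ⟨0, ?_⟩
    rintro _ ⟨n, rfl⟩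
    exact div_nonneg (Real.log_nonneg (hpos' n)) (by positivity)
  have hlim := hsub.tendsto_lim hbdd
  set β := hsub.lim
  have hl2 : 0 < Real.log 2 := Real.log_pos (by norm_num)
  refine ⟨β / Real.log 2, ?_⟩
  have hr : Tendsto (fun m : ℕ => (m : ℝ) / ((m : ℝ) + 1)) atTop (𝓝 1) :=
    tendsto_natCast_div_add_atTop 1
  have hlow : Tendsto (fun m : ℕ => Real.log (F (2 ^ m)) / m * (m / ((m : ℝ) + 1)) / Real.log 2)
      atTop (𝓝 (β / Real.log 2)) := by
    simpa using (hlim.mul hr).div_const (Real.log 2)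
  have hlim' : Tendsto (fun m : ℕ => Real.log (F (2 ^ (m + 1))) / ((m : ℝ) + 1)) atTop (𝓝 β) := by
    have := hlim.comp (tendsto_add_atTop_nat 1)
    refine this.congr fun m => ?_
    simp
  have hr' : Tendsto (fun m : ℕ => ((m : ℝ) / ((m : ℝ) + 1))⁻¹) atTop (𝓝 1) := by
    simpa using hr.inv₀ one_ne_zero
  have hup : Tendsto (fun m : ℕ =>
      Real.log (F (2 ^ (m + 1))) / ((m : ℝ) + 1) * ((m : ℝ) / ((m : ℝ) + 1))⁻¹ / Real.log 2)
      atTop (𝓝 (β / Real.log 2)) := by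
    simpa using (hlim'.mul hr').div_const (Real.log 2)
  refine tendsto_of_tendsto_of_tendsto_of_le_of_le' (hlow.comp tendsto_natLog_two_atTop)
    (hup.comp tendsto_natLog_two_atTop) ?_ ?_
  all_goals
    filter_upwards [eventually_ge_atTop 2] with N hN
    have hm1 : 1 ≤ Nat.log 2 N := Nat.log_pos (by norm_num) hN
    have hN1 : 2 ^ Nat.log 2 N ≤ N := Nat.pow_log_le_self 2 (by omega)
    have hN2 : N ≤ 2 ^ (Nat.log 2 N + 1) := (Nat.lt_pow_succ_log_self (by norm_num) N).le
    simp only [Function.comp]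
    set m := Nat.log 2 N
    have hm : (0 : ℝ) < m := by exact_mod_cast hm1
    have hNpos : (0 : ℝ) < N := by positivity
    have hlogN : 0 < Real.log N := Real.log_pos (by exact_mod_cast hN)
    have hl1 : m * Real.log 2 ≤ Real.log N := by
      rw [← Real.log_pow]
      exact Real.log_le_log (by positivity) (by exact_mod_cast hN1)
    have hl2' : Real.log N ≤ (m + 1) * Real.log 2 := by
      have := Real.log_le_log hNpos (by exact_mod_cast hN2 : (N : ℝ) ≤ (2 : ℝ) ^ (m + 1))
      rwa [Real.log_pow, Nat.cast_add_one] at this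
    have hFN : (1 : ℝ) ≤ F N := by exact_mod_cast hpos N (by omega)
  · have h1 : Real.log (F (2 ^ m)) ≤ Real.log (F N) :=
      Real.log_le_log (by linarith [hpos' m]) (by exact_mod_cast hmono hN1)
    calc _ = Real.log (F (2 ^ m)) / ((m + 1) * Real.log 2) := by field_simp
      _ ≤ Real.log (F N) / Real.log N :=
        div_le_div₀ (Real.log_nonneg hFN) h1 hlogN hl2'
  · have h1 : Real.log (F N) ≤ Real.log (F (2 ^ (m + 1))) :=
      Real.log_le_log (by linarith) (by exact_mod_cast hmono hN2)
    calc _ ≤ Real.log (F (2 ^ (m + 1))) / (m * Real.log 2) :=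
        div_le_div₀ (Real.log_nonneg (hpos' _)) h1 (by positivity) hl1
      _ = _ := by field_simp

theorem exists_tendsto_minCardAPInitial {k : ℕ} (hk : 1 ≤ k) :
    ∃ α : ℝ, Tendsto (fun N : ℕ => Real.log (minCardAPInitial k N) / Real.log N) atTop (𝓝 α) :=
  exists_tendsto_log_div_log_of_submultiplicative (minCardAPInitial_mono k)
    (fun _ => one_le_minCardAPInitial hk) fun _ _ => minCardAPInitial_mul_le hk

/-- By submultiplicativity the growth exponent is also a lower bound. -/
theorem rpow_le_minCardAPInitial {k : ℕ} (hk : 1 ≤ k) {α : ℝ}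
    (hα : Tendsto (fun N : ℕ => Real.log (minCardAPInitial k N) / Real.log N) atTop (𝓝 α))
    {N : ℕ} (hN : 1 ≤ N) : (N : ℝ) ^ α ≤ minCardAPInitial k N := by
  have hF : (1 : ℝ) ≤ minCardAPInitial k N := by exact_mod_cast one_le_minCardAPInitial hk hN
  rcases hN.eq_or_lt with rfl | hN2
  · simpa using hF
  have hlogN : 0 < Real.log N := Real.log_pos (by exact_mod_cast hN2)
  have hle : α ≤ Real.log (minCardAPInitial k N) / Real.log N := by
    -- Along the powers of $N$ the ratios still tend to $\alpha$, and each is at most the ratio at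
    -- $N$ itself.
    refine le_of_tendsto (hα.comp ((tendsto_pow_atTop_atTop_of_one_lt hN2).comp
      (tendsto_add_atTop_nat 1))) (Eventually.of_forall fun m => ?_)
    have h1 : Real.log (minCardAPInitial k (N ^ (m + 1))) ≤
        (m + 1 : ℕ) * Real.log (minCardAPInitial k N) := by
      rw [← Real.log_pow]
      refine Real.log_le_log ?_ (by exact_mod_cast minCardAPInitial_pow_le hk hN m)
      exact_mod_cast one_le_minCardAPInitial hk (Nat.one_le_pow _ _ hN)
    simp only [Function.comp, Nat.cast_pow, Real.log_pow]
    rw [div_le_div_iff₀ (by positivity) hlogN]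
    nlinarith
  rw [le_div_iff₀ hlogN] at hle
  rw [Real.rpow_def_of_pos (by positivity)]
  calc _ ≤ Real.exp (Real.log (minCardAPInitial k N)) := Real.exp_le_exp.2 (by linarith)
    _ = _ := Real.exp_log (by linarith)

theorem minCardAPInitial_exponent_nonneg {k : ℕ} {α : ℝ}
    (hα : Tendsto (fun N : ℕ => Real.log (minCardAPInitial k N) / Real.log N) atTop (𝓝 α)) :
    0 ≤ α :=
  ge_of_tendsto' hα fun _ => div_nonneg (Real.log_natCast_nonneg _) (Real.log_natCast_nonneg _)

/-! ### Covering a finite group by logarithmically many translates -/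

/-- Greedy covering of a finite group by translates of a set of density at least `1/4`. -/
theorem exists_translates_of_density {G : Type*} [AddCommGroup G] [Fintype G] [DecidableEq G]
    {S : Finset G} (hS : Fintype.card G ≤ 4 * S.card) (m : ℕ) :
    ∃ T : Finset G, T.card ≤ m ∧
      4 ^ m * (Finset.univ.filter fun x => ∀ t ∈ T, x - t ∉ S).card ≤ 3 ^ m * Fintype.card G := by
  induction m with
  | zero => exact ⟨∅, by simp⟩
  | succ m ih =>
    obtain ⟨T, hT, h⟩ := ih
    set U := Finset.univ.filter fun x => ∀ t ∈ T, x - t ∉ S with hU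
    -- On average over $t$, the translate $S+t$ catches $|U||S|/|G|\ge|U|/4$ of the uncovered
    -- points, so some $t$ leaves at most three quarters of them.
    have hsum : ∑ t : G, (U.filter fun x => x - t ∈ S).card = U.card * S.card := by
      simp_rw [Finset.card_filter]
      rw [Finset.sum_comm]
      rw [Finset.card_eq_sum_ones U, Finset.sum_mul]
      refine Finset.sum_congr rfl fun x _ => ?_
      rw [← Finset.card_filter, one_mul]
      refine Finset.card_bij (fun t _ => x - t) (by simp) (by simp) fun s hs =>
        ⟨x - s, by simpa using hs, by simp⟩
    obtain ⟨t, ht⟩ : ∃ t : G, U.card ≤ 4 * (U.filter fun x => x - t ∈ S).card := by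
      by_contra! hcon
      have h1 : ∑ t : G, 4 * (U.filter fun x => x - t ∈ S).card < ∑ _t : G, U.card :=
        Finset.sum_lt_sum_of_nonempty Finset.univ_nonempty fun t _ => hcon t
      rw [← Finset.mul_sum, hsum] at h1
      simp only [Finset.sum_const, Finset.card_univ, smul_eq_mul] at h1
      nlinarith [Nat.mul_le_mul_right U.card hS]
    refine ⟨insert t T, (Finset.card_insert_le _ _).trans (by omega), ?_⟩
    have h2 : (Finset.univ.filter fun x => ∀ s ∈ insert t T, x - s ∉ S) =
        U.filter fun x => ¬ (x - t ∈ S) := by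
      ext x
      simp [hU, and_comm]
    have h3 := Finset.card_filter_add_card_filter_not (s := U) (fun x => x - t ∈ S)
    rw [h2, pow_succ, pow_succ]
    have h4 : 4 * (U.filter fun x => ¬ (x - t ∈ S)).card ≤ 3 * U.card := by omega
    calc _ = 4 ^ m * (4 * (U.filter fun x => ¬ (x - t ∈ S)).card) := by ring
      _ ≤ 4 ^ m * (3 * U.card) := Nat.mul_le_mul_left _ h4
      _ = 3 * (4 ^ m * U.card) := by ring
      _ ≤ 3 * (3 ^ m * Fintype.card G) := Nat.mul_le_mul_left _ h
      _ = _ := by ring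

theorem exists_translates_cover {G : Type*} [AddCommGroup G] [Fintype G] [DecidableEq G]
    {S : Finset G} (hS : Fintype.card G ≤ 4 * S.card) :
    ∃ T : Finset G, T.card ≤ 3 * (Nat.log 2 (Fintype.card G) + 1) ∧
      ∀ x, ∃ t ∈ T, x - t ∈ S := by
  set L := Nat.log 2 (Fintype.card G) + 1
  obtain ⟨T, hT, h⟩ := exists_translates_of_density hS (3 * L)
  refine ⟨T, hT, ?_⟩
  by_contra! hcon
  obtain ⟨x, hx⟩ := hcon
  have h1 : 1 ≤ (Finset.univ.filter fun x => ∀ t ∈ T, x - t ∉ S).card :=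
    Finset.card_pos.2 ⟨x, by simpa using hx⟩
  have h2 : Fintype.card G < 2 ^ L := Nat.lt_pow_succ_log_self (by norm_num) _
  -- This is contradictory because $4^3=64>54=3^3\cdot2$; hence $3L$ rounds suffice.
  have h3 : 4 ^ (3 * L) < 3 ^ (3 * L) * 2 ^ L :=
    calc 4 ^ (3 * L) ≤ 4 ^ (3 * L) * _ := Nat.le_mul_of_pos_right _ h1
      _ ≤ 3 ^ (3 * L) * Fintype.card G := h
      _ < _ := Nat.mul_lt_mul_of_pos_left h2 (by positivity)
  rw [pow_mul, pow_mul, ← mul_pow] at h3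
  exact absurd h3 (not_lt.2 (Nat.pow_le_pow_left (by norm_num) L))

/-! ### Rounded dilations with few collisions -/

/-- Cauchy–Schwarz: few collisions force a large image. -/
theorem card_sq_le_card_image_mul_collisions {α β : Type*} [DecidableEq α] [DecidableEq β]
    (D : Finset α) (f : α → β) :
    D.card ^ 2 ≤ (D.image f).card * ((D ×ˢ D).filter fun z => f z.1 = f z.2).card := by
  have h1 : D.card = ∑ b ∈ D.image f, (D.filter fun a => f a = b).card :=
    Finset.card_eq_sum_card_image f D
  have h2 : ((D ×ˢ D).filter fun z => f z.1 = f z.2).card =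
      ∑ b ∈ D.image f, (D.filter fun a => f a = b).card ^ 2 := by
    rw [Finset.card_eq_sum_card_fiberwise (f := fun z => f z.1) (t := D.image f)]
    · refine Finset.sum_congr rfl fun b _ => ?_
      rw [sq, ← Finset.card_product]
      congr 1
      ext ⟨x, y⟩
      simp only [Finset.mem_filter, Finset.mem_product]
      constructor
      · rintro ⟨⟨⟨hx, hy⟩, hxy⟩, rfl⟩
        exact ⟨⟨hx, rfl⟩, hy, hxy.symm⟩
      · rintro ⟨⟨hx, rfl⟩, hy, hxy⟩
        exact ⟨⟨⟨hx, hy⟩, hxy.symm⟩, rfl⟩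
    · intro z hz
      simp only [Finset.coe_filter, Finset.mem_product, Set.mem_ofPred_eq] at hz
      exact Finset.mem_coe.2 (Finset.mem_image_of_mem f hz.1.1)
  rw [h1, h2]
  exact sq_sum_le_card_mul_sum_sq

/-- The rounded dilation `x ↦ ⌊P (t / q) x⌋`. -/
noncomputable def roundedDilation (P q t : ℕ) (x : ℝ) : ℤ := ⌊(P : ℝ) * (t / q) * x⌋

/-- If the two floors differ by a multiple of $P$, the unrounded values differ from that multiple by
less than $1$. Multiplying by $q/P$ places $t(d-e)$ within $q/P$ of a multiple of $q$. -/
theorem exists_mul_sub_mul_lt_of_roundedDilation_eq {P q t : ℕ} (hq : 0 < q) (hP : 0 < P) {d e : ℤ}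
    (h : ((roundedDilation P q t d : ℤ) : ZMod P) = (roundedDilation P q t e : ℤ)) :
    ∃ m : ℤ, (P : ℤ) * |t * (d - e) - m * q| < q := by
  rw [ZMod.intCast_eq_intCast_iff_dvd_sub] at h
  obtain ⟨c, hc⟩ := h
  refine ⟨-c, ?_⟩
  have hq' : (0 : ℝ) < q := by exact_mod_cast hq
  have hP' : (0 : ℝ) < P := by exact_mod_cast hP
  unfold roundedDilation at hc
  set u := (P : ℝ) * (t / q) * (d : ℝ) with hu
  set v := (P : ℝ) * (t / q) * (e : ℝ) with hv
  have hc' : ((⌊v⌋ : ℤ) : ℝ) - ⌊u⌋ = P * c := by exact_mod_cast hc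
  have h1 : |u - v + P * c| < 1 := by
    rw [abs_lt]
    constructor <;>
      linarith [Int.floor_le u, Int.lt_floor_add_one u, Int.floor_le v, Int.lt_floor_add_one v]
  have h2 : (u - v + P * c) * q = P * (t * (d - e) - -c * q) := by
    rw [hu, hv]
    field_simp
    ring
  have h3 : (P : ℝ) * |t * ((d : ℝ) - e) - -c * q| < q := by
    rw [← abs_of_pos hP', ← abs_mul, ← h2, abs_mul, abs_of_pos hq']
    nlinarith
  exact_mod_cast h3

open Classical in
/-- For a dilate of a nonzero residue, few multipliers land near `0`. -/
theorem card_near_multiples_le {P q : ℕ} (hP : 0 < P) (hq : q.Prime) (hPq : P ≤ q) {s : ℤ}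
    (hs : ¬ (q : ℤ) ∣ s) :
    P * ((Finset.range q).filter fun t : ℕ => ∃ m : ℤ, (P : ℤ) * |t * s - m * q| < q).card
      ≤ 3 * q := by
  have : Fact q.Prime := ⟨hq⟩
  set W := (Finset.range q).filter fun t : ℕ => ∃ m : ℤ, (P : ℤ) * |t * s - m * q| < q
  have hs' : ((s : ℤ) : ZMod q) ≠ 0 := by
    rwa [Ne, ZMod.intCast_zmod_eq_zero_iff_dvd]
  -- Multiplication by $s$ is injective modulo $q$, so multipliers are counted by residues in
  -- $[-q/P,q/P]$. There are at most $2\lfloor q/P\rfloor+1$ of these, and $P\le q$ turns this into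
  -- $3q/P$.
  have hcard : W.card ≤ (Finset.Icc (-(q / P : ℕ) : ℤ) (q / P : ℕ)).card := by
    calc W.card = (W.image fun t : ℕ => ((t : ZMod q) * (s : ZMod q))).card := by
          refine (Finset.card_image_of_injOn fun t ht t' ht' h => ?_).symm
          have h1 : (t : ZMod q) = t' := mul_right_cancel₀ hs' h
          have ht1 := Finset.mem_range.1 (Finset.mem_filter.1 ht).1
          have ht2 := Finset.mem_range.1 (Finset.mem_filter.1 ht').1
          rw [ZMod.natCast_eq_natCast_iff'] at h1
          rwa [Nat.mod_eq_of_lt ht1, Nat.mod_eq_of_lt ht2] at h1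
      _ ≤ ((Finset.Icc (-(q / P : ℕ) : ℤ) (q / P : ℕ)).image fun z : ℤ => (z : ZMod q)).card := by
          refine Finset.card_le_card fun x hx => ?_
          obtain ⟨t, ht, rfl⟩ := Finset.mem_image.1 hx
          obtain ⟨m, hm⟩ := (Finset.mem_filter.1 ht).2
          refine Finset.mem_image.2 ⟨t * s - m * q, ?_, by simp⟩
          rw [Finset.mem_Icc, ← abs_le]
          have h2 : |(t : ℤ) * s - m * q| ≤ (q : ℤ) / P := by
            rw [Int.le_ediv_iff_mul_le (by exact_mod_cast hP)]
            linarith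
          exact_mod_cast h2
      _ ≤ _ := Finset.card_image_le
  rw [Int.card_Icc] at hcard
  have h3 : P * (q / P) ≤ q := Nat.mul_div_le q P
  have h4 : W.card ≤ 2 * (q / P) + 1 := by omega
  nlinarith [Nat.mul_le_mul_left P h4]

/-- Some rounded dilation has few collisions modulo `P`. -/
theorem exists_roundedDilation_card_image {D : Finset ℤ} (hD : 0 < D.card) :
    ∃ q t : ℕ, D.card ≤ 4 * (D.image fun d : ℤ =>
      ((roundedDilation D.card q t d : ℤ) : ZMod D.card)).card := by
  classical
  set P := D.card with hP
  set R := ∑ d ∈ D, d.natAbs with hR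
  -- The prime exceeds $2R\ge|d-e|$, so it divides no nonzero difference, and it exceeds $P$.
  obtain ⟨q, hq1, hq⟩ := Nat.exists_infinite_primes (P + 2 * R + 1)
  have hqs : ∀ d ∈ D, ∀ e ∈ D, d ≠ e → ¬ (q : ℤ) ∣ d - e := by
    intro d hd e he hne hdvd
    have h1 : d.natAbs ≤ R := Finset.single_le_sum (f := fun d : ℤ => d.natAbs)
      (fun _ _ => Nat.zero_le _) hd
    have h2 : e.natAbs ≤ R := Finset.single_le_sum (f := fun d : ℤ => d.natAbs)
      (fun _ _ => Nat.zero_le _) he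
    have h3 := Int.eq_zero_of_abs_lt_dvd hdvd (by rw [abs_lt]; omega)
    omega
  set f : ℕ → ℤ → ZMod P := fun t d => ((roundedDilation P q t d : ℤ) : ZMod P) with hf
  have htotal : ∑ t ∈ Finset.range q, ((D ×ˢ D).filter fun z => f t z.1 = f t z.2).card
      ≤ q * (4 * P) := by
    simp_rw [Finset.card_filter]
    rw [Finset.sum_comm]
    simp_rw [← Finset.card_filter]
    rw [Finset.sum_product]
    -- The diagonal term contributes $q$; the fewer than $P$ others contribute at most $3q/P$ each.
    have hrow : ∀ d ∈ D, ∑ e ∈ D, ((Finset.range q).filter fun t => f t d = f t e).card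
        ≤ 4 * q := by
      intro d hd
      have hoff : ∀ e ∈ D.erase d,
          P * ((Finset.range q).filter fun t => f t d = f t e).card ≤ 3 * q := by
        intro e he
        obtain ⟨hne, he⟩ := Finset.mem_erase.1 he
        refine le_trans (Nat.mul_le_mul_left P (Finset.card_le_card fun t ht => ?_))
          (card_near_multiples_le hD hq (by omega) (hqs d hd e he hne.symm))
        rw [Finset.mem_filter] at ht ⊢
        exact ⟨ht.1, exists_mul_sub_mul_lt_of_roundedDilation_eq hq.pos hD ht.2⟩
      rw [← Finset.add_sum_erase D _ hd]
      have h1 : ((Finset.range q).filter fun t => f t d = f t d).card = q := by simp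
      have h2 : P * ∑ e ∈ D.erase d, ((Finset.range q).filter fun t => f t d = f t e).card
          ≤ P * (3 * q) := by
        rw [Finset.mul_sum]
        refine (Finset.sum_le_sum hoff).trans ?_
        rw [Finset.sum_const, smul_eq_mul]
        exact Nat.mul_le_mul_right _ (Finset.card_erase_le)
      have h3 := Nat.le_of_mul_le_mul_left h2 hD
      omega
    refine (Finset.sum_le_sum hrow).trans (le_of_eq ?_)
    rw [Finset.sum_const, smul_eq_mul, ← hP]
    ring
  obtain ⟨t, -, ht⟩ : ∃ t ∈ Finset.range q,
      ((D ×ˢ D).filter fun z => f t z.1 = f t z.2).card ≤ 4 * P := by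
    refine Finset.exists_le_of_sum_le (Finset.nonempty_range_iff.2 hq.ne_zero) ?_
    simpa using htotal
  refine ⟨q, t, ?_⟩
  have h5 := card_sq_le_card_image_mul_collisions D (f t)
  rw [← hP] at h5
  have h6 : P * P ≤ P * (4 * (D.image (f t)).card) := by
    calc P * P = P ^ 2 := by ring
      _ ≤ _ := h5
      _ ≤ _ := Nat.mul_le_mul_left _ ht
      _ = _ := by ring
  exact Nat.le_of_mul_le_mul_left h6 hD

/-! ### From many common differences to all of $1,\dots,P$ -/

/-- Rounding an arithmetic progression perturbs it by a bounded amount. -/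
theorem floor_add_nsmul_sub_mem (u v : ℝ) (i : ℕ) :
    ⌊u + i * v⌋ - (⌊u⌋ + i * ⌊v⌋) ∈ Set.Icc (0 : ℤ) i := by
  have hi : (0 : ℝ) ≤ i := by positivity
  constructor
  · rw [sub_nonneg, Int.le_floor]
    push_cast
    nlinarith [Int.floor_le u, Int.floor_le v]
  · rw [sub_le_iff_le_add, ← Int.lt_add_one_iff, Int.floor_lt]
    push_cast
    nlinarith [Int.lt_floor_add_one u, Int.lt_floor_add_one v]

/-- A set of reals with `P` integer common differences yields a set of integers, of almost the
same size, with all the common differences `1, …, P`. -/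
theorem minCardAPInitial_card_le {k : ℕ} {A : Finset ℝ} {D : Finset ℤ} (hD : 0 < D.card)
    (hA : ∀ d ∈ D, ContainsAP (A : Set ℝ) k (d : ℝ)) :
    minCardAPInitial k D.card ≤
      (k + 1) ^ 3 * (3 * (Nat.log 2 D.card + 1)) * A.card := by
  classical
  obtain ⟨q, t, hqt⟩ := exists_roundedDilation_card_image hD
  set P := D.card with hP
  have : NeZero P := ⟨hD.ne'⟩
  set φ := roundedDilation P q t with hφ
  set S := D.image fun d : ℤ => ((φ d : ℤ) : ZMod P) with hS
  obtain ⟨T, hT, hTS⟩ := exists_translates_cover (G := ZMod P) (S := S)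
    (by rwa [ZMod.card])
  rw [ZMod.card] at hT
  -- the rounded set, modulo `P`
  set A₂ : Finset (ZMod P) := Finset.image₂ (fun (a : ℝ) (j : ℕ) => ((φ a : ℤ) : ZMod P) - j)
    A (Finset.range (k + 1)) with hA₂
  have hA₂S : ∀ s ∈ S, ContainsAP (A₂ : Set (ZMod P)) k s := by
    intro s hs
    obtain ⟨d, hd, rfl⟩ := Finset.mem_image.1 hs
    obtain ⟨a, ha⟩ := hA d hd
    refine ⟨((φ a : ℤ) : ZMod P), fun i h1 h2 => ?_⟩
    -- The rounded $i$-th term is off by some $j\in\{0,\dots,i\}$; subtracting all $j\le k$ in the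
    -- definition of $A_2$ absorbs this.
    have h3 := floor_add_nsmul_sub_mem ((P : ℝ) * (t / q) * a) ((P : ℝ) * (t / q) * d) i
    have h4 : (P : ℝ) * (t / q) * a + i * ((P : ℝ) * (t / q) * d) =
        (P : ℝ) * (t / q) * (a + i • (d : ℝ)) := by
      rw [nsmul_eq_mul]
      ring
    rw [h4] at h3
    change φ (a + i • (d : ℝ)) - (φ a + i * φ d) ∈ _ at h3
    obtain ⟨j, hj⟩ := Int.eq_ofNat_of_zero_le h3.1
    have hjk : j ≤ i := by exact_mod_cast hj ▸ h3.2
    rw [hA₂, Finset.coe_image₂]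
    refine ⟨_, ha i h1 h2, j, by simp only [Finset.coe_range, Set.mem_Iio]; omega, ?_⟩
    have h5 : φ (a + i • (d : ℝ)) = φ a + i * φ d + j := by omega
    simp only [h5]
    push_cast
    rw [nsmul_eq_mul]
    ring
  -- all common differences modulo `P`
  set A₃ : Finset (ZMod P) := Finset.image₂ (fun (a : ZMod P) (z : ZMod P × ℕ) => a + z.2 • z.1)
    A₂ (T ×ˢ Finset.range (k + 1)) with hA₃
  have hA₃' : ∀ s, ContainsAP (A₃ : Set (ZMod P)) k s := by
    intro s
    obtain ⟨τ, hτ, hs⟩ := hTS s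
    obtain ⟨a, ha⟩ := hA₂S _ hs
    refine ⟨a, fun i h1 h2 => ?_⟩
    rw [hA₃, Finset.coe_image₂]
    -- The difference $s-\tau$ lies in $S$, and adding $i\tau$ to the $i$-th term corrects it to
    -- $s$.
    refine ⟨_, ha i h1 h2, (τ, i), ?_, ?_⟩
    · simp only [Finset.coe_product, Set.mem_prod, Finset.mem_coe, Finset.mem_range]
      exact ⟨hτ, by omega⟩
    · simp only [smul_sub]
      abel
  -- lift to the integers
  set A₄ : Finset ℤ := Finset.image₂ (fun (a : ZMod P) (j : ℕ) => ((a.val : ℤ) + j * P))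
    A₃ (Finset.range (k + 1)) with hA₄
  have hA₄' : ∀ d ∈ Finset.Icc (1 : ℤ) P, ContainsAP (A₄ : Set ℤ) k d := by
    intro d hd
    rw [Finset.mem_Icc] at hd
    lift d to ℕ using by omega
    obtain ⟨a, ha⟩ := hA₃' (d : ZMod P)
    refine ⟨(a.val : ℤ), fun i h1 h2 => ?_⟩
    rw [hA₄, Finset.coe_image₂]
    -- The quotient is at most $k$, because the representative of $a$ is below $P$ and $id\le kP$.
    refine ⟨_, ha i h1 h2, (a.val + i * d) / P, ?_, ?_⟩
    · simp only [Finset.coe_range, Set.mem_Iio]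
      rw [Nat.div_lt_iff_lt_mul hD]
      have h3 : a.val < P := ZMod.val_lt a
      have h4 : i * d ≤ k * P := Nat.mul_le_mul h2 (by omega)
      linarith
    · have h3 : a + i • (d : ZMod P) = ((a.val + i * d : ℕ) : ZMod P) := by
        push_cast
        rw [ZMod.natCast_zmod_val, nsmul_eq_mul]
      simp only [h3]
      rw [ZMod.val_natCast, nsmul_eq_mul]
      have h4 := Nat.mod_add_div (a.val + i * d) P
      rw [mul_comm P] at h4
      exact_mod_cast h4
  have c2 : A₂.card ≤ A.card * (k + 1) := by
    simpa using Finset.card_image₂_le (fun (a : ℝ) (j : ℕ) => ((φ a : ℤ) : ZMod P) - j)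
      A (Finset.range (k + 1))
  have c3 : A₃.card ≤ A₂.card * (T.card * (k + 1)) := by
    refine (Finset.card_image₂_le _ _ _).trans_eq ?_
    rw [Finset.card_product, Finset.card_range]
  have c4 : A₄.card ≤ A₃.card * (k + 1) := by
    refine (Finset.card_image₂_le _ _ _).trans_eq ?_
    rw [Finset.card_range]
  calc minCardAPInitial k P ≤ A₄.card := minCardAPInitial_le hA₄'
    _ ≤ A.card * (k + 1) * (3 * (Nat.log 2 P + 1) * (k + 1)) * (k + 1) := by
      refine c4.trans (Nat.mul_le_mul_right _ (c3.trans ?_))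
      exact Nat.mul_le_mul c2 (Nat.mul_le_mul_right _ hT)
    _ = _ := by ring

theorem injOn_sum_mul_pow {n L : ℕ} :
    Set.InjOn (fun d : Fin n → ℕ => ∑ j, d j * L ^ (j : ℕ)) {d | ∀ j, d j < L} := by
  intro d hd e he h
  have h1 : finFunctionFinEquiv (fun j => (⟨d j, hd j⟩ : Fin L)) =
      finFunctionFinEquiv (fun j => (⟨e j, he j⟩ : Fin L)) := by
    apply Fin.ext
    simpa [finFunctionFinEquiv_apply] using h
  have h2 := finFunctionFinEquiv.injective h1
  funext j
  simpa using congrFun h2 j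

/-- The map $x\mapsto\sum_j x_jL^j$ is linear, so it preserves progressions, and by uniqueness of
base-$L$ digits it is injective on $D$ once $L$ exceeds all coordinates. It may merge points of $A$,
which only helps. -/
theorem minCardAPInitial_card_le_dim {n k : ℕ} {A : Finset (Fin n → ℝ)} {D : Finset (Fin n → ℕ)}
    (hD : 0 < D.card)
    (hA : ∀ d ∈ D, ContainsAP (A : Set (Fin n → ℝ)) k (fun i => (d i : ℝ))) :
    minCardAPInitial k D.card ≤
      (k + 1) ^ 3 * (3 * (Nat.log 2 D.card + 1)) * A.card := by
  classical
  set L := ∑ d ∈ D, ∑ j, d j + 1 with hL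
  have hDL : ∀ d ∈ D, ∀ j, d j < L := by
    intro d hd j
    have h1 : d j ≤ ∑ j, d j := Finset.single_le_sum (fun _ _ => Nat.zero_le _) (Finset.mem_univ j)
    have h2 : ∑ j, d j ≤ ∑ d ∈ D, ∑ j, d j :=
      Finset.single_le_sum (f := fun d : Fin n → ℕ => ∑ j, d j) (fun _ _ => Nat.zero_le _) hd
    omega
  set D' : Finset ℤ := D.image fun d => ((∑ j : Fin n, d j * L ^ (j : ℕ) : ℕ) : ℤ) with hD'
  have hcard : D'.card = D.card := Finset.card_image_of_injOn fun d hd e he h =>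
    injOn_sum_mul_pow (L := L) (hDL d hd) (hDL e he) (by exact_mod_cast h)
  set A' : Finset ℝ := A.image fun x => ∑ j : Fin n, x j * (L : ℝ) ^ (j : ℕ) with hA'
  have h := minCardAPInitial_card_le (k := k) (A := A') (D := D') (by omega) ?_
  · rw [hcard] at h
    exact h.trans (Nat.mul_le_mul_left _ Finset.card_image_le)
  · intro d' hd'
    obtain ⟨d, hd, rfl⟩ := Finset.mem_image.1 hd'
    obtain ⟨a, ha⟩ := hA d hd
    refine ⟨∑ j : Fin n, a j * (L : ℝ) ^ (j : ℕ), fun i h1 h2 => ?_⟩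
    rw [hA', Finset.coe_image]
    refine ⟨_, ha i h1 h2, ?_⟩
    push_cast
    simp only [Pi.add_apply, Pi.smul_apply, add_mul, Finset.sum_add_distrib]
    simp only [nsmul_eq_mul, Finset.mul_sum, mul_assoc]

/-! ### Exponents of $F'_{n,k}$ and $F'_k$ -/

theorem natLog_two_add_one_le_rpow {η : ℝ} (hη : 0 < η) :
    ∃ C : ℝ, 0 < C ∧ ∀ P : ℕ, 1 ≤ P → ((Nat.log 2 P + 1 : ℕ) : ℝ) ≤ C * (P : ℝ) ^ η := by
  have hl2 : 0 < Real.log 2 := Real.log_pos (by norm_num)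
  refine ⟨1 / (η * Real.log 2) + 1, by positivity, fun P hP => ?_⟩
  have hP' : (1 : ℝ) ≤ P := by exact_mod_cast hP
  have h1 : (Nat.log 2 P : ℝ) * Real.log 2 ≤ Real.log P := by
    rw [← Real.log_pow]
    exact Real.log_le_log (by positivity) (by exact_mod_cast Nat.pow_log_le_self 2 (by omega))
  have h2 : Real.log P ≤ (P : ℝ) ^ η / η := Real.log_le_rpow_div (by positivity) hη
  have h3 : (1 : ℝ) ≤ (P : ℝ) ^ η := Real.one_le_rpow hP' hη.le
  have h4 : (Nat.log 2 P : ℝ) ≤ (P : ℝ) ^ η / η / Real.log 2 := by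
    rw [le_div_iff₀ hl2]
    linarith
  push_cast
  calc _ ≤ (P : ℝ) ^ η / η / Real.log 2 + (P : ℝ) ^ η := by linarith
    _ = _ := by field_simp

/-- Packages the core inequality for use with exponents: the logarithm is absorbed into $P^\eta$,
and $F_k(P)\ge P^\alpha$. Here $c$ plays the role of $|A|$. -/
theorem exists_rpow_le_of_minCardAPInitial_le {k : ℕ} (hk : 1 ≤ k) {α : ℝ}
    (hα : Tendsto (fun N : ℕ => Real.log (minCardAPInitial k N) / Real.log N) atTop (𝓝 α))
    {η : ℝ} (hη : 0 < η) :
    ∃ C : ℝ, 0 < C ∧ ∀ P c : ℕ, 1 ≤ P →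
      minCardAPInitial k P ≤ (k + 1) ^ 3 * (3 * (Nat.log 2 P + 1)) * c →
      (P : ℝ) ^ α ≤ C * (P : ℝ) ^ η * c := by
  obtain ⟨C, hC, h⟩ := natLog_two_add_one_le_rpow hη
  refine ⟨(k + 1) ^ 3 * 3 * C, by positivity, fun P c hP hA => ?_⟩
  have h1 : (minCardAPInitial k P : ℝ) ≤
      (k + 1) ^ 3 * (3 * ((Nat.log 2 P + 1 : ℕ) : ℝ)) * c := by
    exact_mod_cast hA
  calc _ ≤ _ := rpow_le_minCardAPInitial hk hα hP
    _ ≤ _ := h1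
    _ ≤ (k + 1) ^ 3 * (3 * (C * (P : ℝ) ^ η)) * c := by
      gcongr
      exact h _ hP
    _ = _ := by ring

theorem tendsto_log_div_log_of_rpow_le {u v : ℕ → ℕ} {β : ℝ}
    (hlow : ∀ η : ℝ, 0 < η → ∃ C : ℝ, 0 < C ∧ ∀ N : ℕ, 1 ≤ N → (N : ℝ) ^ (β - η) ≤ C * u N)
    (huv : ∀ N, 1 ≤ N → u N ≤ v N)
    (hv : Tendsto (fun N : ℕ => Real.log (v N) / Real.log N) atTop (𝓝 β)) :
    Tendsto (fun N : ℕ => Real.log (u N) / Real.log N) atTop (𝓝 β) := by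
  have hupos : ∀ N : ℕ, 1 ≤ N → (0 : ℝ) < u N := by
    intro N hN
    obtain ⟨C, hC, h⟩ := hlow 1 one_pos
    have h1 : (0 : ℝ) < C * u N := lt_of_lt_of_le (by positivity) (h N hN)
    exact pos_of_mul_pos_right h1 hC.le
  refine tendsto_order.2 ⟨fun a ha => ?_, fun a ha => ?_⟩
  · obtain ⟨C, hC, h⟩ := hlow ((β - a) / 2) (by linarith)
    have h1 : Tendsto (fun N : ℕ => (β - (β - a) / 2) - Real.log C / Real.log N) atTop
        (𝓝 (β - (β - a) / 2 - 0)) :=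
      tendsto_const_nhds.sub
        ((Real.tendsto_log_atTop.comp tendsto_natCast_atTop_atTop).const_div_atTop _)
    filter_upwards [h1.eventually_const_lt (show a < _ by linarith), eventually_ge_atTop 2]
      with N hN hN2
    refine hN.trans_le ?_
    have hlogN : 0 < Real.log N := Real.log_pos (by exact_mod_cast hN2)
    have hu := hupos N (by omega)
    have h2 := Real.log_le_log (by positivity) (h N (by omega))
    rw [Real.log_rpow (by positivity), Real.log_mul hC.ne' hu.ne'] at h2
    rw [sub_le_iff_le_add, ← add_div, le_div_iff₀ hlogN]
    linarith
  · filter_upwards [hv.eventually_lt_const ha, eventually_ge_atTop 2] with N hN hN2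
    refine lt_of_le_of_lt ?_ hN
    have hlogN : 0 < Real.log N := Real.log_pos (by exact_mod_cast hN2)
    gcongr
    · exact hupos N (by omega)
    · exact_mod_cast huv N (by omega)

theorem exists_finset_minCardAPDim_le (n k N : ℕ) :
    ∃ (A : Finset (Fin n → ℝ)) (D : Finset (Fin n → ℕ)),
      A.card ≤ minCardAPInitial k N ^ n ∧ D.card = N ^ n ∧
      ∀ d ∈ D, ContainsAP (A : Set (Fin n → ℝ)) k (fun i => (d i : ℝ)) := by
  classical
  obtain ⟨A, hA, h⟩ := exists_card_eq_minCardAPInitial k N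
  refine ⟨(Fintype.piFinset fun _ : Fin n => A).image fun x j => (x j : ℝ),
    Fintype.piFinset fun _ => Finset.Icc 1 N, ?_, by simp, fun d hd => ?_⟩
  · refine Finset.card_image_le.trans_eq ?_
    simp [hA]
  · have hd' : ∀ j, ContainsAP (A : Set ℤ) k (d j : ℤ) := fun j => h _ (by
      have := Fintype.mem_piFinset.1 hd j
      simp only [Finset.mem_Icc] at this ⊢
      omega)
    choose a ha using hd'
    refine ⟨fun j => (a j : ℝ), fun i h1 h2 => ?_⟩
    rw [Finset.coe_image]
    refine ⟨fun j => a j + i • (d j : ℤ), ?_, ?_⟩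
    · exact Finset.mem_coe.2 (Fintype.mem_piFinset.2 fun j => ha j i h1 h2)
    · funext j
      simp

theorem minCardAPDim_le (n k N : ℕ) : minCardAPDim n k N ≤ minCardAPInitial k N ^ n := by
  obtain ⟨A, D, hA, hD, h⟩ := exists_finset_minCardAPDim_le n k N
  exact le_trans (Nat.sInf_le ⟨A, D, rfl, hD, h⟩) hA

theorem exists_card_eq_minCardAPDim (n k N : ℕ) :
    ∃ (A : Finset (Fin n → ℝ)) (D : Finset (Fin n → ℕ)),
      A.card = minCardAPDim n k N ∧ D.card = N ^ n ∧
      ∀ d ∈ D, ContainsAP (A : Set (Fin n → ℝ)) k (fun i => (d i : ℝ)) := by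
  obtain ⟨A, D, -, hD, h⟩ := exists_finset_minCardAPDim_le n k N
  exact Nat.sInf_mem (s := {c : ℕ | ∃ (A : Finset (Fin n → ℝ)) (D : Finset (Fin n → ℕ)),
    A.card = c ∧ D.card = N ^ n ∧
      ∀ d ∈ D, ContainsAP (A : Set (Fin n → ℝ)) k (fun i => (d i : ℝ))}) ⟨_, A, D, rfl, hD, h⟩

theorem exists_finset_minCardAPDistinct_le (k N : ℕ) :
    ∃ A D : Finset ℤ, A.card = minCardAPInitial k N ∧ D.card = N ∧
      ∀ d ∈ D, ContainsAP (A : Set ℤ) k d := by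
  obtain ⟨A, hA, h⟩ := exists_card_eq_minCardAPInitial k N
  exact ⟨A, Finset.Icc 1 N, hA, by simp, h⟩

theorem minCardAPDistinct_le (k N : ℕ) : minCardAPDistinct k N ≤ minCardAPInitial k N :=
  Nat.sInf_le (exists_finset_minCardAPDistinct_le k N)

theorem exists_card_eq_minCardAPDistinct (k N : ℕ) :
    ∃ A D : Finset ℤ, A.card = minCardAPDistinct k N ∧ D.card = N ∧
      ∀ d ∈ D, ContainsAP (A : Set ℤ) k d :=
  Nat.sInf_mem (s := {c : ℕ | ∃ A D : Finset ℤ,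
    A.card = c ∧ D.card = N ∧ ∀ d ∈ D, ContainsAP (A : Set ℤ) k d})
    ⟨_, exists_finset_minCardAPDistinct_le k N⟩

theorem tendsto_minCardAPDim {n k : ℕ} (hn : 1 ≤ n) (hk : 1 ≤ k) {α : ℝ}
    (hα : Tendsto (fun N : ℕ => Real.log (minCardAPInitial k N) / Real.log N) atTop (𝓝 α)) :
    Tendsto (fun N : ℕ => Real.log (minCardAPDim n k N) / Real.log N) atTop (𝓝 (n * α)) := by
  have hn' : (0 : ℝ) < n := by exact_mod_cast hn
  refine tendsto_log_div_log_of_rpow_le (fun η hη => ?_) (fun N _ => minCardAPDim_le n k N) ?_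
  -- The number of differences is $N^n$, so an $\eta/n$ loss there is an $\eta$ loss in $N$.
  · obtain ⟨C, hC, h⟩ := exists_rpow_le_of_minCardAPInitial_le hk hα (div_pos hη hn')
    refine ⟨C, hC, fun N hN => ?_⟩
    obtain ⟨A, D, hA, hD, hAD⟩ := exists_card_eq_minCardAPDim n k N
    have hPpos : 1 ≤ N ^ n := Nat.one_le_pow _ _ hN
    have h1 := h (N ^ n) A.card hPpos (by
      rw [← hD]
      exact minCardAPInitial_card_le_dim (by omega) hAD)
    rw [hA] at h1
    have hN' : (0 : ℝ) < N := by exact_mod_cast hN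
    have e1 : ((N ^ n : ℕ) : ℝ) ^ α = (N : ℝ) ^ (n * α) := by
      rw [Nat.cast_pow, ← Real.rpow_natCast, ← Real.rpow_mul hN'.le]
    have e2 : ((N ^ n : ℕ) : ℝ) ^ (η / n) = (N : ℝ) ^ η := by
      rw [Nat.cast_pow, ← Real.rpow_natCast, ← Real.rpow_mul hN'.le]
      congr 1
      field_simp
    rw [e1, e2] at h1
    rw [Real.rpow_sub hN', div_le_iff₀ (by positivity)]
    linarith
  · refine (hα.const_mul (n : ℝ)).congr fun N => ?_
    rw [Nat.cast_pow, Real.log_pow, mul_div_assoc]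

theorem tendsto_minCardAPDistinct {k : ℕ} (hk : 1 ≤ k) {α : ℝ}
    (hα : Tendsto (fun N : ℕ => Real.log (minCardAPInitial k N) / Real.log N) atTop (𝓝 α)) :
    Tendsto (fun N : ℕ => Real.log (minCardAPDistinct k N) / Real.log N) atTop (𝓝 α) := by
  refine tendsto_log_div_log_of_rpow_le (fun η hη => ?_) (fun N _ => minCardAPDistinct_le k N) hα
  obtain ⟨C, hC, h⟩ := exists_rpow_le_of_minCardAPInitial_le hk hα hη
  refine ⟨C, hC, fun N hN => ?_⟩
  obtain ⟨A, D, hA, hD, hAD⟩ := exists_card_eq_minCardAPDistinct k N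
  have hcast : ∀ d ∈ D, ContainsAP (A.image (fun a : ℤ => (a : ℝ)) : Set ℝ) k (d : ℝ) := by
    intro d hd
    obtain ⟨a, ha⟩ := hAD d hd
    refine ⟨a, fun i h1 h2 => ?_⟩
    rw [Finset.coe_image]
    exact ⟨_, ha i h1 h2, by simp⟩
  have h1 := h N A.card hN (by
    have := minCardAPInitial_card_le (k := k) (by omega : 0 < D.card) hcast
    rw [hD] at this
    exact this.trans (Nat.mul_le_mul_left _ Finset.card_image_le))
  rw [hA] at h1
  have hN' : (0 : ℝ) < N := by exact_mod_cast hN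
  rw [Real.rpow_sub hN', div_le_iff₀ (by positivity)]
  linarith

/-! ### Digit sets and the upper bound for the Minkowski dimension -/

/-- The reals `∑ aⱼ b^{-(j+1)}` with generalized base-`b` digits `aⱼ ∈ A`. -/
def digitSet (A : Finset ℤ) (b : ℕ) : Set ℝ :=
  {x | ∃ a : ℕ → ℤ, (∀ j, a j ∈ A) ∧ x = ∑' j, (a j : ℝ) * ((b : ℝ) ^ (j + 1))⁻¹}

theorem hasSum_inv_pow_succ {b : ℕ} (hb : 2 ≤ b) :
    HasSum (fun j : ℕ => ((b : ℝ) ^ (j + 1))⁻¹) (((b : ℝ) - 1)⁻¹) := by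
  have hb' : (2 : ℝ) ≤ b := by exact_mod_cast hb
  have h := (hasSum_geometric_of_lt_one (r := (b : ℝ)⁻¹) (by positivity)
    (inv_lt_one_of_one_lt₀ (by linarith))).mul_right (b : ℝ)⁻¹
  have h1 : (1 - (b : ℝ)⁻¹)⁻¹ * (b : ℝ)⁻¹ = ((b : ℝ) - 1)⁻¹ := by
    rw [← mul_inv, sub_mul, inv_mul_cancel₀ (by positivity), one_mul]
  rw [h1] at h
  simpa [pow_succ, mul_comm] using h

theorem summable_mul_inv_pow_succ {b : ℕ} (hb : 2 ≤ b) {c : ℕ → ℝ} {R : ℝ}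
    (hc : ∀ j, |c j| ≤ R) : Summable fun j : ℕ => c j * ((b : ℝ) ^ (j + 1))⁻¹ := by
  refine Summable.of_norm_bounded ((hasSum_inv_pow_succ hb).summable.mul_left R) fun j => ?_
  rw [norm_mul, Real.norm_eq_abs, Real.norm_of_nonneg (by positivity)]
  gcongr
  exact hc j

theorem abs_tsum_mul_inv_pow_succ_le {b : ℕ} (hb : 2 ≤ b) {c : ℕ → ℝ} {R : ℝ}
    (hc : ∀ j, |c j| ≤ R) : |∑' j : ℕ, c j * ((b : ℝ) ^ (j + 1))⁻¹| ≤ R := by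
  have hb' : (2 : ℝ) ≤ b := by exact_mod_cast hb
  have hR : 0 ≤ R := (abs_nonneg _).trans (hc 0)
  have h := tsum_of_norm_bounded ((hasSum_inv_pow_succ hb).mul_left R)
    (f := fun j : ℕ => c j * ((b : ℝ) ^ (j + 1))⁻¹) fun j => by
      rw [norm_mul, Real.norm_eq_abs, Real.norm_of_nonneg (by positivity)]
      gcongr
      exact hc j
  rw [Real.norm_eq_abs] at h
  refine h.trans (mul_le_of_le_one_right hR (inv_le_one_of_one_le₀ (by linarith)))

theorem abs_tsum_sub_sum_le {b : ℕ} (hb : 2 ≤ b) {c : ℕ → ℝ} {R : ℝ}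
    (hc : ∀ j, |c j| ≤ R) (m : ℕ) :
    |∑' j : ℕ, c j * ((b : ℝ) ^ (j + 1))⁻¹ - ∑ j : Fin m, c j * ((b : ℝ) ^ ((j : ℕ) + 1))⁻¹| ≤
      R * ((b : ℝ) ^ m)⁻¹ := by
  rw [Fin.sum_univ_eq_sum_range (fun j => c j * ((b : ℝ) ^ (j + 1))⁻¹) m,
    ← (summable_mul_inv_pow_succ hb hc).sum_add_tsum_nat_add m, add_sub_cancel_left]
  have h1 : ∀ j, c (j + m) * ((b : ℝ) ^ (j + m + 1))⁻¹ =
      ((b : ℝ) ^ m)⁻¹ * (c (j + m) * ((b : ℝ) ^ (j + 1))⁻¹) := fun j => by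
    rw [show j + m + 1 = m + (j + 1) by ring, pow_add, mul_inv]
    ring
  simp_rw [h1]
  rw [tsum_mul_left, abs_mul, abs_of_nonneg (by positivity), mul_comm]
  gcongr
  exact abs_tsum_mul_inv_pow_succ_le hb fun j => hc (j + m)

/-- Expand $d$ in base $b$ and choose for each digit $\delta_j$ a progression in $A$ with that
difference. The starts $a_j$ are the digits of the starting point, and no carrying occurs since the
digits are unrestricted integers. -/
theorem containsAP_digitSet {A : Finset ℤ} {b k : ℕ} (hb : 2 ≤ b)
    (hA : ∀ d : ℕ, d ≤ b → ContainsAP (A : Set ℤ) k d) {d : ℝ} (hd : d ∈ Set.Icc (0 : ℝ) 1) :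
    ContainsAP (digitSet A b) k d := by
  obtain ⟨δ, -, rfl⟩ := Real.ofDigits_SurjOn (b := b) (by omega) hd
  have hA' : ∀ j, ContainsAP (A : Set ℤ) k ((δ j : ℕ) : ℤ) := fun j => hA _ (δ j).2.le
  choose a ha using hA'
  rcases Nat.eq_zero_or_pos k with rfl | hk
  · exact ⟨0, fun i h1 h2 => by omega⟩
  have hAb : ∀ z ∈ A, |(z : ℝ)| ≤ ∑ z ∈ A, |(z : ℝ)| := fun z hz =>
    Finset.single_le_sum (f := fun z : ℤ => |(z : ℝ)|) (fun _ _ => abs_nonneg _) hz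
  have hδb : ∀ j, |((δ j : ℕ) : ℝ)| ≤ b := fun j => by
    rw [abs_of_nonneg (by positivity)]
    exact_mod_cast (δ j).2.le
  -- The starts need not lie in $A$; the first term $a_j+\delta_j$ does, which bounds them and makes
  -- the series summable.
  have hab : ∀ j, |(a j : ℝ)| ≤ ∑ z ∈ A, |(z : ℝ)| + b := fun j => by
    have h1 := hAb _ (ha j 1 le_rfl hk)
    have h2 := hδb j
    push_cast at h1
    rw [one_smul] at h1
    calc |(a j : ℝ)| = |((a j : ℝ) + ((δ j : ℕ) : ℝ)) - ((δ j : ℕ) : ℝ)| := by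
          rw [add_sub_cancel_right]
      _ ≤ |(a j : ℝ) + ((δ j : ℕ) : ℝ)| + |((δ j : ℕ) : ℝ)| := abs_sub _ _
      _ ≤ _ := add_le_add h1 h2
  refine ⟨∑' j, (a j : ℝ) * ((b : ℝ) ^ (j + 1))⁻¹, fun i h1 h2 =>
    ⟨fun j => a j + i • ((δ j : ℕ) : ℤ), fun j => ha j i h1 h2, ?_⟩⟩
  have hs1 := summable_mul_inv_pow_succ hb hab
  have hs2 := summable_mul_inv_pow_succ hb hδb
  rw [Real.ofDigits, nsmul_eq_mul, ← tsum_mul_left]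
  unfold Real.ofDigitsTerm
  rw [← hs1.tsum_add (hs2.mul_left _)]
  refine tsum_congr fun j => ?_
  dsimp only
  rw [nsmul_eq_mul]
  push_cast
  ring

theorem coveredByBoxes_of_fintype {n : ℕ} {ι : Type*} [Fintype ι] {E : Set (Fin n → ℝ)} {ε : ℝ}
    (a b : ι → Fin n → ℝ) (hab : ∀ j i, a j i ≤ b j i ∧ b j i - a j i ≤ ε)
    (hE : E ⊆ ⋃ j, Set.Icc (a j) (b j)) : CoveredByBoxes E ε (Fintype.card ι) := by
  let e := (Fintype.equivFin ι).symm
  refine ⟨a ∘ e, b ∘ e, fun j i => hab _ _, hE.trans fun x hx => ?_⟩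
  obtain ⟨j, hj⟩ := Set.mem_iUnion.1 hx
  exact Set.mem_iUnion.2 ⟨e.symm j, by simpa using hj⟩

/-- Truncating each coordinate after $m$ digits leaves $|A|^{mn}$ centres and an error of at most
$Rb^{-m}$. -/
theorem coveredByBoxes_pi_digitSet (n : ℕ) {A : Finset ℤ} {b : ℕ} (hb : 2 ≤ b) {R : ℝ}
    (hR : ∀ z ∈ A, |(z : ℝ)| ≤ R) (hR0 : 0 ≤ R) {ε : ℝ} (m : ℕ) (hm : 2 * R ≤ ε * (b : ℝ) ^ m) :
    CoveredByBoxes (Set.univ.pi fun _ : Fin n => digitSet A b) ε (A.card ^ (m * n)) := by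
  have hb' : (0 : ℝ) < (b : ℝ) ^ m := by positivity
  have hε : 2 * (R * ((b : ℝ) ^ m)⁻¹) ≤ ε := by
    rwa [← mul_assoc, ← div_eq_mul_inv, div_le_iff₀ hb']
  set ρ := R * ((b : ℝ) ^ m)⁻¹ with hρ
  have hρ0 : 0 ≤ ρ := by positivity
  let s : (Fin n → Fin m → A) → Fin n → ℝ := fun c i =>
    ∑ j : Fin m, ((c i j : ℤ) : ℝ) * ((b : ℝ) ^ ((j : ℕ) + 1))⁻¹
  have h := coveredByBoxes_of_fintype (ι := Fin n → Fin m → A)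
    (E := Set.univ.pi fun _ : Fin n => digitSet A b) (ε := ε)
    (fun c i => s c i - ρ) (fun c i => s c i + ρ) (fun c i => ⟨by linarith, by linarith⟩) ?_
  · have hcard : Fintype.card (Fin n → Fin m → A) = A.card ^ (m * n) := by
      simp [pow_mul]
    rwa [hcard] at h
  · intro x hx
    have hx' : ∀ i, x i ∈ digitSet A b := fun i => hx i (Set.mem_univ i)
    choose a ha hxa using hx'
    refine Set.mem_iUnion.2 ⟨fun i j => ⟨a i j, ha i j⟩, ?_⟩
    have h1 : ∀ i, |x i - s (fun i j => ⟨a i j, ha i j⟩) i| ≤ ρ := fun i => by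
      rw [hxa i]
      exact abs_tsum_sub_sum_le hb (c := fun j => (a i j : ℝ)) (fun j => hR _ (ha i j)) m
    exact ⟨fun i => by have := abs_le.1 (h1 i); dsimp only; linarith,
      fun i => by have := abs_le.1 (h1 i); dsimp only; linarith⟩

theorem boxNumber_le {n : ℕ} {E : Set (Fin n → ℝ)} {ε : ℝ} {m : ℕ} (hm : 0 < m)
    (h : CoveredByBoxes E ε m) : boxNumber E ε ≤ m :=
  iInf₂_le m ⟨hm, h⟩

theorem log_natCast_ennreal {m : ℕ} (hm : 0 < m) :
    ENNReal.log (m : ENNReal) = ((Real.log m : ℝ) : EReal) := by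
  rw [← ENNReal.ofReal_natCast, ENNReal.log_ofReal_of_pos (by exact_mod_cast hm)]

theorem tendsto_log_one_div_nhdsGT_zero :
    Tendsto (fun ε : ℝ => Real.log (1 / ε)) (𝓝[>] 0) atTop := by
  simp only [one_div]
  exact Real.tendsto_log_atTop.comp tendsto_inv_nhdsGT_zero

theorem minkowskiDim_pi_digitSet_le (n : ℕ) {A : Finset ℤ} (hA : A.Nonempty) {b : ℕ}
    (hb : 2 ≤ b) :
    minkowskiDim (Set.univ.pi fun _ : Fin n => digitSet A b) ≤
      ((n * (Real.log A.card / Real.log b) : ℝ) : EReal) := by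
  set E := Set.univ.pi fun _ : Fin n => digitSet A b
  set R : ℝ := ∑ z ∈ A, |(z : ℝ)| + 1 with hRdef
  have hS0 : 0 ≤ ∑ z ∈ A, |(z : ℝ)| := Finset.sum_nonneg fun _ _ => abs_nonneg _
  have hR1 : 1 ≤ R := by linarith
  have hR : ∀ z ∈ A, |(z : ℝ)| ≤ R := fun z hz => by
    have := Finset.single_le_sum (f := fun z : ℤ => |(z : ℝ)|) (fun _ _ => abs_nonneg _) hz
    linarith
  have hcard : 0 < A.card := hA.card_pos
  have hlogA : 0 ≤ Real.log A.card := Real.log_natCast_nonneg _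
  have hb' : (2 : ℝ) ≤ b := by exact_mod_cast hb
  have hlogb : 0 < Real.log b := Real.log_pos (by linarith)
  let g : ℝ → ℝ := fun ε =>
    n * Real.log A.card * ((Real.log (2 * R) / Real.log b + 1) / Real.log (1 / ε) +
      1 / Real.log b)
  have hg : Tendsto g (𝓝[>] 0) (𝓝 (n * (Real.log A.card / Real.log b))) := by
    have h1 := ((tendsto_log_one_div_nhdsGT_zero.const_div_atTop
      (Real.log (2 * R) / Real.log b + 1)).add_const (1 / Real.log b)).const_mul
      (n * Real.log A.card)
    convert h1 using 2
    ring
  have hg' : Tendsto (fun ε => ((g ε : ℝ) : EReal)) (𝓝[>] 0)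
      (𝓝 ((n * (Real.log A.card / Real.log b) : ℝ) : EReal)) :=
    (continuous_coe_real_ereal.tendsto _).comp hg
  rw [← hg'.limsup_eq]
  refine limsup_le_limsup ?_
  filter_upwards [Ioo_mem_nhdsGT (zero_lt_one (α := ℝ))] with ε hε
  have hε0 : 0 < ε := hε.1
  have hlogε : 0 < Real.log (1 / ε) := Real.log_pos (by rw [lt_div_iff₀ hε0]; linarith [hε.2])
  have hlogR : 0 ≤ Real.log (2 * R) := Real.log_nonneg (by linarith)
  -- The solution of $b^y=2R/\varepsilon$: rounding up gives enough digits for boxes of side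
  -- $\varepsilon$.
  set y := (Real.log (2 * R) + Real.log (1 / ε)) / Real.log b with hy
  have hy0 : 0 ≤ y := by positivity
  set m := ⌈y⌉₊ with hm
  have hm1 : y ≤ m := Nat.le_ceil y
  have hm2 : (m : ℝ) ≤ y + 1 := (Nat.ceil_lt_add_one hy0).le
  have hpow : 2 * R ≤ ε * (b : ℝ) ^ m := by
    rw [hy, div_le_iff₀ hlogb, ← Real.log_pow, ← Real.log_mul (by positivity) (by positivity)] at hm1
    have h2 := (Real.log_le_log_iff (by positivity) (by positivity)).1 hm1
    rw [mul_one_div, div_le_iff₀ hε0] at h2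
    linarith
  have hcov := coveredByBoxes_pi_digitSet n hb hR (by linarith) m hpow
  have hMpos : 0 < A.card ^ (m * n) := by positivity
  have hbox := boxNumber_le hMpos hcov
  have h1 : ENNReal.log (boxNumber E ε : ENNReal) ≤
      ((n * Real.log A.card * (y + 1) : ℝ) : EReal) := by
    calc ENNReal.log (boxNumber E ε : ENNReal)
        ≤ ENNReal.log ((A.card ^ (m * n) : ℕ) : ENNReal) := by
          refine ENNReal.log_monotone ?_
          exact_mod_cast ENat.toENNReal_mono hbox
      _ = ((Real.log (A.card ^ (m * n) : ℕ) : ℝ) : EReal) := log_natCast_ennreal hMpos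
      _ ≤ _ := by
          rw [EReal.coe_le_coe_iff, Nat.cast_pow, Real.log_pow, Nat.cast_mul]
          have : (0 : ℝ) ≤ n * Real.log A.card := by positivity
          nlinarith
  calc _ ≤ ((n * Real.log A.card * (y + 1) : ℝ) : EReal) / ((Real.log (1 / ε) : ℝ) : EReal) :=
        EReal.div_le_div_right_of_nonneg (by exact_mod_cast hlogε.le) h1
    _ = ((g ε : ℝ) : EReal) := by
      rw [← EReal.coe_div]
      congr 1
      simp only [g, hy]
      field_simp
      ring

theorem minkowskiAP_le_log_div_log {n k b : ℕ} (hk : 1 ≤ k) (hb : 2 ≤ b) :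
    minkowskiAP n k ≤
      ((n * (Real.log (minCardAPInitial k b) / Real.log b) : ℝ) : EReal) := by
  obtain ⟨A, hA, hne, h⟩ := exists_finset_containsAP_le hk (by omega : 1 ≤ b)
  rw [← hA]
  refine (iInf₂_le _ fun d hd => ?_).trans (minkowskiDim_pi_digitSet_le n hne hb)
  have h1 : ∀ i, ContainsAP (digitSet A b) k (d i) := fun i =>
    containsAP_digitSet hb h ⟨hd.1 i, hd.2 i⟩
  choose a ha using h1
  exact ⟨a, fun t h1 h2 i _ => ha i t h1 h2⟩

theorem minkowskiAP_le {n k : ℕ} (hk : 1 ≤ k) {α : ℝ}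
    (hα : Tendsto (fun N : ℕ => Real.log (minCardAPInitial k N) / Real.log N) atTop (𝓝 α)) :
    minkowskiAP n k ≤ ((n * α : ℝ) : EReal) := by
  refine ge_of_tendsto ((continuous_coe_real_ereal.tendsto _).comp (hα.const_mul (n : ℝ))) ?_
  filter_upwards [eventually_ge_atTop 2] with b hb
  exact minkowskiAP_le_log_div_log hk hb

/-! ### The lower bound for the packing dimension -/

theorem packingDim_le_minkowskiDim {n : ℕ} (E : Set (Fin n → ℝ)) :
    packingDim E ≤ minkowskiDim E :=
  (iInf₂_le (fun _ => E) (Set.subset_iUnion (fun _ : ℕ => E) 0)).trans (by simp)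

theorem packingAP_le_minkowskiAP (n k : ℕ) : packingAP n k ≤ minkowskiAP n k :=
  iInf₂_mono fun B _ => packingDim_le_minkowskiDim B

theorem exists_coveredByBoxes_of_minkowskiDim_lt {n : ℕ} {E : Set (Fin n → ℝ)} {s : ℝ}
    (hs : minkowskiDim E < s) :
    ∀ᶠ ε : ℝ in 𝓝[>] 0, ∃ m : ℕ, CoveredByBoxes E ε m ∧ (m : ℝ) ≤ (1 / ε) ^ s := by
  filter_upwards [eventually_lt_of_limsup_lt hs, Ioo_mem_nhdsGT (zero_lt_one (α := ℝ))]
    with ε h hε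
  have hε0 : 0 < ε := hε.1
  have hlogε : 0 < Real.log (1 / ε) := Real.log_pos (by rw [lt_div_iff₀ hε0]; linarith [hε.2])
  rw [EReal.div_lt_iff (by exact_mod_cast hlogε) (EReal.coe_ne_top _), ← EReal.coe_mul,
    ← Real.log_rpow (by positivity), ← ENNReal.log_ofReal_of_pos (by positivity),
    ENNReal.log_lt_log_iff] at h
  have hne : boxNumber E ε ≠ ⊤ := by
    intro htop
    rw [htop, ENat.toENNReal_top] at h
    exact not_top_lt h
  obtain ⟨M, hM⟩ := ENat.ne_top_iff_exists.1 hne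
  have h1 : boxNumber E ε < ((M + 1 : ℕ) : ℕ∞) := by
    rw [← hM]
    exact_mod_cast Nat.lt_succ_self M
  rw [boxNumber] at h1
  obtain ⟨m, hm⟩ := iInf_lt_iff.1 h1
  obtain ⟨hcov, hm⟩ := iInf_lt_iff.1 hm
  refine ⟨m, hcov.2, ?_⟩
  have h2 : m ≤ M := by
    have : m < M + 1 := by exact_mod_cast hm
    omega
  rw [← hM, ENat.toENNReal_coe, ← ENNReal.ofReal_natCast,
    ENNReal.ofReal_lt_ofReal_iff (by positivity)] at h
  exact (Nat.cast_le.2 h2).trans h.le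

/-- A set covered by `m` boxes of side `1/N` meets at most `2ⁿ m` cells of the grid of
mesh `1/N`. -/
theorem exists_finset_floor_mem {n m N : ℕ} {E : Set (Fin n → ℝ)} (hN : 0 < N)
    (h : CoveredByBoxes E (1 / (N : ℝ)) m) :
    ∃ A : Finset (Fin n → ℤ), A.card ≤ m * 2 ^ n ∧
      ∀ x ∈ E, (fun i => ⌊(N : ℝ) * x i⌋) ∈ A := by
  classical
  obtain ⟨a, b, hab, hE⟩ := h
  have hN' : (0 : ℝ) < N := by exact_mod_cast hN
  refine ⟨Finset.univ.biUnion fun j : Fin m => Fintype.piFinset fun i =>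
    Finset.Icc ⌊(N : ℝ) * a j i⌋ (⌊(N : ℝ) * a j i⌋ + 1), ?_, fun x hx => ?_⟩
  · refine (Finset.card_biUnion_le_card_mul _ _ (2 ^ n) fun j _ => ?_).trans_eq (by simp)
    rw [Fintype.card_piFinset]
    refine le_of_eq ?_
    have : ∀ z : ℤ, (Finset.Icc z (z + 1)).card = 2 := fun z => by
      rw [Int.card_Icc]
      omega
    simp [this]
  · obtain ⟨j, hj⟩ := Set.mem_iUnion.1 (hE hx)
    refine Finset.mem_biUnion.2 ⟨j, Finset.mem_univ _, Fintype.mem_piFinset.2 fun i => ?_⟩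
    rw [Finset.mem_Icc]
    have h1 : a j i ≤ x i := hj.1 i
    have h2 : x i ≤ a j i + 1 / N := by linarith [hj.2 i, (hab j i).2]
    constructor
    · exact Int.floor_le_floor (by gcongr)
    · rw [← Int.floor_add_one]
      refine Int.floor_le_floor ?_
      calc (N : ℝ) * x i ≤ N * (a j i + 1 / N) := by gcongr
        _ = _ := by field_simp

/-- A subset of the unit cube of outer volume `c` meets at least `c Nⁿ` cells of the grid of
mesh `1/N`. -/
theorem exists_finset_grid {n N : ℕ} (hN : 0 < N) {Δ : Set (Fin n → ℝ)}
    (hΔ : Δ ⊆ Set.Icc 0 1) :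
    ∃ D : Finset (Fin n → ℕ), D.card ≤ (N + 1) ^ n ∧
      (MeasureTheory.volume Δ).toReal * (N : ℝ) ^ n ≤ D.card ∧
      ∀ δ ∈ D, ∃ d ∈ Δ, ∀ i, (δ i : ℤ) = ⌊(N : ℝ) * d i⌋ := by
  classical
  have hN' : (0 : ℝ) < N := by exact_mod_cast hN
  set D := (Fintype.piFinset fun _ : Fin n => Finset.range (N + 1)).filter
    fun δ => ∃ d ∈ Δ, ∀ i, (δ i : ℤ) = ⌊(N : ℝ) * d i⌋ with hD
  refine ⟨D, (Finset.card_filter_le _ _).trans_eq (by simp), ?_,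
    fun δ hδ => (Finset.mem_filter.1 hδ).2⟩
  have hcover : Δ ⊆ ⋃ δ ∈ D,
      Set.Icc (fun i => (δ i : ℝ) / N) (fun i => ((δ i : ℝ) + 1) / N) := by
    intro d hd
    have h0 : ∀ i, 0 ≤ (N : ℝ) * d i := fun i => mul_nonneg hN'.le ((hΔ hd).1 i)
    have h1 : ∀ i, (N : ℝ) * d i ≤ N := fun i => mul_le_of_le_one_right hN'.le ((hΔ hd).2 i)
    refine Set.mem_iUnion₂.2 ⟨fun i => ⌊(N : ℝ) * d i⌋₊, ?_, ?_⟩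
    · refine Finset.mem_filter.2 ⟨Fintype.mem_piFinset.2 fun i => ?_, d, hd, fun i => ?_⟩
      · rw [Finset.mem_range, Nat.lt_succ_iff]
        exact Nat.floor_le_of_le (h1 i)
      · exact Int.natCast_floor_eq_floor (h0 i)
    · constructor <;> intro i
      · simp only
        rw [div_le_iff₀ hN']
        linarith [Nat.floor_le (h0 i)]
      · simp only
        rw [le_div_iff₀ hN']
        linarith [Nat.lt_floor_add_one ((N : ℝ) * d i)]
  have hvol : ∀ δ : Fin n → ℕ, MeasureTheory.volume
      (Set.Icc (fun i => (δ i : ℝ) / N) (fun i => ((δ i : ℝ) + 1) / N)) =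
      ENNReal.ofReal ((1 / (N : ℝ)) ^ n) := by
    intro δ
    rw [Real.volume_Icc_pi]
    have : ∀ i, ((δ i : ℝ) + 1) / N - δ i / N = 1 / N := fun i => by ring
    simp only [this, Finset.prod_const, Finset.card_univ, Fintype.card_fin]
    rw [ENNReal.ofReal_pow (by positivity)]
  have hle : MeasureTheory.volume Δ ≤ ENNReal.ofReal (D.card * (1 / (N : ℝ)) ^ n) := by
    refine (MeasureTheory.measure_mono hcover).trans
      ((MeasureTheory.measure_biUnion_finset_le _ _).trans_eq ?_)
    simp only [hvol, Finset.sum_const, nsmul_eq_mul]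
    rw [ENNReal.ofReal_mul (by positivity), ENNReal.ofReal_natCast]
  have h2 := ENNReal.toReal_le_of_le_ofReal (by positivity) hle
  rwa [one_div, inv_pow, ← div_eq_mul_inv, le_div_iff₀ (by positivity)] at h2

/-- Rounding to the grid of mesh `1/N` turns the progressions with common difference in `Δ` into
progressions of lattice points. -/
theorem exists_finset_containsAP_of_floor_mem {n k N : ℕ} {T Δ : Set (Fin n → ℝ)}
    (hΔ : ∀ d ∈ Δ, ContainsAP T k d) {A : Finset (Fin n → ℤ)}
    (hA : ∀ x ∈ T, (fun i => ⌊(N : ℝ) * x i⌋) ∈ A) :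
    ∃ A' : Finset (Fin n → ℝ), A'.card ≤ A.card * (k + 1) ^ n ∧
      ∀ δ : Fin n → ℕ, (∃ d ∈ Δ, ∀ i, (δ i : ℤ) = ⌊(N : ℝ) * d i⌋) →
        ContainsAP (A' : Set (Fin n → ℝ)) k (fun i => (δ i : ℝ)) := by
  classical
  refine ⟨Finset.image₂ (fun (a : Fin n → ℤ) (e : Fin n → ℕ) i => (a i : ℝ) - e i) A
    (Fintype.piFinset fun _ => Finset.range (k + 1)),
    (Finset.card_image₂_le _ _ _).trans_eq (by simp), ?_⟩
  rintro δ ⟨d, hd, hδ⟩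
  obtain ⟨a, ha⟩ := hΔ d hd
  refine ⟨fun i => (⌊(N : ℝ) * a i⌋ : ℝ), fun t h1 h2 => ?_⟩
  have h3 : ∀ i, ∃ e : ℕ, e ≤ t ∧
      ⌊(N : ℝ) * (a + t • d) i⌋ = ⌊(N : ℝ) * a i⌋ + t * (δ i : ℤ) + e := by
    intro i
    have h4 := floor_add_nsmul_sub_mem ((N : ℝ) * a i) ((N : ℝ) * d i) t
    have h5 : (N : ℝ) * a i + t * ((N : ℝ) * d i) = (N : ℝ) * (a + t • d) i := by
      rw [Pi.add_apply, Pi.smul_apply, nsmul_eq_mul]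
      ring
    rw [h5, ← hδ i] at h4
    obtain ⟨e, he⟩ := Int.eq_ofNat_of_zero_le h4.1
    exact ⟨e, by exact_mod_cast he ▸ h4.2, by omega⟩
  choose e he h6 using h3
  rw [Finset.coe_image₂]
  refine ⟨_, hA _ (ha t h1 h2), e, ?_, ?_⟩
  · exact Finset.mem_coe.2 (Fintype.mem_piFinset.2 fun i =>
      Finset.mem_range.2 (by have := he i; omega))
  · funext i
    dsimp only
    rw [h6, Pi.add_apply, Pi.smul_apply, nsmul_eq_mul]
    push_cast
    ring

/-- Finitely many pieces already contain progressions for a set of common differences of positive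
outer volume. -/
theorem exists_volume_pos_of_cover {n k : ℕ} {B : Set (Fin n → ℝ)} (hB : ContainsAllAPs B k)
    {S : ℕ → Set (Fin n → ℝ)} (hS : B ⊆ ⋃ j, S j) :
    ∃ (J : ℕ) (Δ : Set (Fin n → ℝ)), Δ ⊆ Set.Icc 0 1 ∧
      0 < (MeasureTheory.volume Δ).toReal ∧
      ∀ d ∈ Δ, ContainsAP (⋃ j ∈ Finset.range J, S j) k d := by
  let Δ : ℕ → Set (Fin n → ℝ) := fun J =>
    {d | d ∈ Set.Icc 0 1 ∧ ContainsAP (⋃ j ∈ Finset.range J, S j) k d}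
  have hcover : Set.Icc (0 : Fin n → ℝ) 1 ⊆ ⋃ J, Δ J := by
    intro d hd
    obtain ⟨a, ha⟩ := hB d hd
    have h1 : ∀ i : ℕ, ∃ j : ℕ, 1 ≤ i → i ≤ k → a + i • d ∈ S j := by
      intro i
      by_cases hi : 1 ≤ i ∧ i ≤ k
      · obtain ⟨j, hj⟩ := Set.mem_iUnion.1 (hS (ha i hi.1 hi.2))
        exact ⟨j, fun _ _ => hj⟩
      · exact ⟨0, fun h1 h2 => absurd ⟨h1, h2⟩ hi⟩
    choose f hf using h1
    -- A progression has only $k$ terms, so finitely many pieces contain it. Countable subadditivity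
    -- of outer measure then yields a non-null $\Delta_J$, with no measurability needed.
    refine Set.mem_iUnion.2 ⟨(Finset.range (k + 1)).sup f + 1, hd, a, fun i h1 h2 => ?_⟩
    refine Set.mem_iUnion₂.2 ⟨f i, ?_, hf i h1 h2⟩
    rw [Finset.mem_range, Nat.lt_succ_iff]
    exact Finset.le_sup (f := f) (Finset.mem_range.2 (by omega))
  obtain ⟨J, hJ⟩ : ∃ J, MeasureTheory.volume (Δ J) ≠ 0 := by
    by_contra! hcon
    have h1 := MeasureTheory.measure_mono_null hcover (MeasureTheory.measure_iUnion_null hcon)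
    rw [Real.volume_Icc_pi] at h1
    simp at h1
  have hsub : Δ J ⊆ Set.Icc 0 1 := fun d hd => hd.1
  refine ⟨J, Δ J, hsub, ENNReal.toReal_pos hJ ?_, fun d hd => hd.2⟩
  refine ne_top_of_le_ne_top ?_ (MeasureTheory.measure_mono hsub)
  rw [Real.volume_Icc_pi]
  simp

theorem nonpos_of_forall_rpow_le {θ K : ℝ} (h : ∀ᶠ N : ℕ in atTop, (N : ℝ) ^ θ ≤ K) : θ ≤ 0 := by
  by_contra! hθ
  have h1 := (tendsto_rpow_atTop hθ).comp tendsto_natCast_atTop_atTop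
  obtain ⟨N, hN1, hN2⟩ := (h.and (h1.eventually_gt_atTop K)).exists
  exact absurd hN1 (not_le.2 hN2)

/-- Rounding at scale $1/N$ gives $O(N^s)$ points serving between $cN^n$ and $(2N)^n$ lattice
differences. The core inequality yields $N^{n\alpha}\lesssim N^{n\eta+s}$; let $N\to\infty$, then
$\eta\to0$. -/
theorem mul_exponent_le_of_cover {n k : ℕ} (hk : 1 ≤ k) {α : ℝ}
    (hα : Tendsto (fun N : ℕ => Real.log (minCardAPInitial k N) / Real.log N) atTop (𝓝 α))
    {B : Set (Fin n → ℝ)} (hB : ContainsAllAPs B k)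
    {S : ℕ → Set (Fin n → ℝ)} (hS : B ⊆ ⋃ j, S j) {s : ℝ}
    (hs : ∀ j, minkowskiDim (S j) < s) : n * α ≤ s := by
  classical
  obtain ⟨J, Δ, hΔ1, hΔ0, hΔ⟩ := exists_volume_pos_of_cover hB hS
  set c := (MeasureTheory.volume Δ).toReal
  -- Needed to pass from $cN^n\le|D|$ to $(cN^n)^\alpha\le|D|^\alpha$.
  have hα0 := minCardAPInitial_exponent_nonneg hα
  have hcov : ∀ᶠ N : ℕ in atTop, ∀ j ∈ Finset.range J,
      ∃ m : ℕ, CoveredByBoxes (S j) (1 / (N : ℝ)) m ∧ (m : ℝ) ≤ (N : ℝ) ^ s := by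
    rw [Filter.eventually_all_finset]
    intro j _
    have h1 : Tendsto (fun N : ℕ => 1 / (N : ℝ)) atTop (𝓝[>] 0) := by
      simp only [one_div]
      exact tendsto_inv_atTop_nhdsGT_zero.comp tendsto_natCast_atTop_atTop
    filter_upwards [h1.eventually (exists_coveredByBoxes_of_minkowskiDim_lt (hs j))] with N hN
    simpa using hN
  have key : ∀ η : ℝ, 0 < η → n * α - n * η - s ≤ 0 := by
    intro η hη
    obtain ⟨C, hC, hCle⟩ := exists_rpow_le_of_minCardAPInitial_le hk hα hη
    refine nonpos_of_forall_rpow_le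
      (K := C * ((2 : ℝ) ^ n) ^ η * (J * 2 ^ n * (k + 1) ^ n) / c ^ α) ?_
    filter_upwards [hcov, eventually_ge_atTop 1] with N hN hN1
    have hN' : (0 : ℝ) < N := by exact_mod_cast hN1
    have hcells : ∀ j : ℕ, ∃ A : Finset (Fin n → ℤ), j ∈ Finset.range J →
        (A.card : ℝ) ≤ (N : ℝ) ^ s * 2 ^ n ∧ ∀ x ∈ S j, (fun i => ⌊(N : ℝ) * x i⌋) ∈ A := by
      intro j
      by_cases hj : j ∈ Finset.range J
      · obtain ⟨m, hm, hms⟩ := hN j hj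
        obtain ⟨A, hA, hA'⟩ := exists_finset_floor_mem hN1 hm
        refine ⟨A, fun _ => ⟨?_, hA'⟩⟩
        calc (A.card : ℝ) ≤ m * 2 ^ n := by exact_mod_cast hA
          _ ≤ _ := by gcongr
      · exact ⟨∅, fun h => absurd h hj⟩
    choose A hA using hcells
    obtain ⟨A', hA'card, hA'⟩ := exists_finset_containsAP_of_floor_mem (N := N) hΔ
      (A := (Finset.range J).biUnion A) fun x hx => by
        obtain ⟨j, hj, hxj⟩ := Set.mem_iUnion₂.1 hx
        exact Finset.mem_biUnion.2 ⟨j, hj, (hA j hj).2 x hxj⟩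
    obtain ⟨D, hD1, hD2, hD3⟩ := exists_finset_grid hN1 hΔ1
    have hDpos : 0 < D.card := by
      have : (0 : ℝ) < D.card := lt_of_lt_of_le (by positivity) hD2
      exact_mod_cast this
    have h1 := hCle D.card A'.card hDpos
      (minCardAPInitial_card_le_dim hDpos fun δ hδ => hA' δ (hD3 δ hδ))
    have h2 : (A'.card : ℝ) ≤ J * 2 ^ n * (k + 1) ^ n * (N : ℝ) ^ s := by
      have h3 : (((Finset.range J).biUnion A).card : ℝ) ≤ J * ((N : ℝ) ^ s * 2 ^ n) := by
        calc (((Finset.range J).biUnion A).card : ℝ)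
            ≤ ∑ j ∈ Finset.range J, ((A j).card : ℝ) := by exact_mod_cast Finset.card_biUnion_le
          _ ≤ ∑ _j ∈ Finset.range J, (N : ℝ) ^ s * 2 ^ n :=
            Finset.sum_le_sum fun j hj => (hA j hj).1
          _ = _ := by simp
      calc (A'.card : ℝ) ≤ ((Finset.range J).biUnion A).card * (k + 1) ^ n := by
            exact_mod_cast hA'card
        _ ≤ J * ((N : ℝ) ^ s * 2 ^ n) * (k + 1) ^ n := by gcongr
        _ = _ := by ring
    have h4 : (D.card : ℝ) ≤ 2 ^ n * (N : ℝ) ^ n := by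
      rw [← mul_pow]
      calc (D.card : ℝ) ≤ ((N : ℝ) + 1) ^ n := by exact_mod_cast hD1
        _ ≤ _ := by
          gcongr
          linarith [(Nat.one_le_cast (α := ℝ)).2 hN1]
    have hpow : ∀ β : ℝ, ((N : ℝ) ^ n) ^ β = (N : ℝ) ^ (n * β) := fun β => by
      rw [← Real.rpow_natCast, ← Real.rpow_mul hN'.le]
    have h5 : c ^ α * (N : ℝ) ^ (n * α) ≤
        C * (((2 : ℝ) ^ n) ^ η * (N : ℝ) ^ (n * η)) *
          (J * 2 ^ n * (k + 1) ^ n * (N : ℝ) ^ s) := by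
      rw [← hpow, ← hpow, ← Real.mul_rpow hΔ0.le (by positivity),
        ← Real.mul_rpow (by positivity) (by positivity)]
      calc (c * (N : ℝ) ^ n) ^ α ≤ (D.card : ℝ) ^ α := by gcongr
        _ ≤ C * (D.card : ℝ) ^ η * A'.card := h1
        _ ≤ _ := by gcongr
    rw [le_div_iff₀ (by positivity), Real.rpow_sub hN', Real.rpow_sub hN', div_div,
      div_mul_eq_mul_div, div_le_iff₀ (by positivity)]
    calc _ = c ^ α * (N : ℝ) ^ (n * α) := by ring
      _ ≤ _ := h5
      _ = _ := by ring
  refine le_of_forall_pos_le_add fun η hη => ?_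
  rcases Nat.eq_zero_or_pos n with rfl | hn
  · have := key 1 one_pos
    simp only [Nat.cast_zero, zero_mul] at this ⊢
    linarith
  · have hn' : (0 : ℝ) < n := by exact_mod_cast hn
    have h1 := key (η / n) (by positivity)
    rw [mul_div_cancel₀ _ hn'.ne'] at h1
    linarith

theorem le_packingAP {n k : ℕ} (hk : 1 ≤ k) {α : ℝ}
    (hα : Tendsto (fun N : ℕ => Real.log (minCardAPInitial k N) / Real.log N) atTop (𝓝 α)) :
    ((n * α : ℝ) : EReal) ≤ packingAP n k := by
  refine le_iInf₂ fun B hB => le_iInf₂ fun S hS => ?_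
  by_contra! hlt
  obtain ⟨s, hs1, hs2⟩ := EReal.lt_iff_exists_real_btwn.1 hlt
  have h := mul_exponent_le_of_cover hk hα hB hS fun j => (le_iSup _ j).trans_lt hs1
  exact absurd (EReal.coe_lt_coe_iff.1 hs2) (not_lt.2 h)

/-! ### Equivalence of the conjectures -/

theorem iteratedExponentLimit_iff {F : ℕ → ℕ → ℕ} {g : ℕ → ℝ} {a : ℝ}
    (hg : ∀ k, 1 ≤ k →
      Tendsto (fun N : ℕ => Real.log (F k N) / Real.log N) atTop (𝓝 (g k))) :
    IteratedExponentLimit F a ↔ Tendsto g atTop (𝓝 a) := by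
  refine ⟨?_, fun h => ⟨g, hg, h⟩⟩
  rintro ⟨L, hL, hLa⟩
  refine hLa.congr' ?_
  filter_upwards [eventually_ge_atTop 1] with k hk
  exact tendsto_nhds_unique (hL k hk) (hg k hk)

theorem tendsto_natCast_mul_iff {n : ℕ} (hn : 1 ≤ n) {g : ℕ → ℝ} :
    Tendsto (fun k => n * g k) atTop (𝓝 (n : ℝ)) ↔ Tendsto g atTop (𝓝 1) := by
  have hn' : (n : ℝ) ≠ 0 := by positivity
  constructor <;> intro h
  · simpa [hn'] using h.const_mul (n : ℝ)⁻¹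
  · simpa using h.const_mul (n : ℝ)

theorem tendsto_ereal_iff {n : ℕ} (hn : 1 ≤ n) {g : ℕ → ℝ} {f : ℕ → EReal}
    (hf : ∀ k, 1 ≤ k → f k = ((n * g k : ℝ) : EReal)) :
    Tendsto f atTop (𝓝 (n : EReal)) ↔ Tendsto g atTop (𝓝 1) := by
  rw [← tendsto_natCast_mul_iff hn, ← EReal.tendsto_coe, EReal.coe_coe_eq_natCast]
  refine tendsto_congr' ?_
  filter_upwards [eventually_ge_atTop 1] with k hk
  exact hf k hk

theorem mainTheorem2 :
    (∀ n k : ℕ, 1 ≤ n → 1 ≤ k → ∃ L : ℝ,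
      packingAP n k = (L : EReal) ∧ minkowskiAP n k = (L : EReal) ∧
      Tendsto (fun N : ℕ => Real.log (minCardAPDim n k N) / Real.log N) atTop (𝓝 L)) ∧
    (∀ k : ℕ, 1 ≤ k → ∃ L : ℝ,
      packingAP 1 k = (L : EReal) ∧ minkowskiAP 1 k = (L : EReal) ∧
      Tendsto (fun N : ℕ => Real.log (minCardAPDistinct k N) / Real.log N) atTop (𝓝 L)) ∧
    (∀ n : ℕ, 1 ≤ n →
      [ArithmeticKakeyaInitial, ArithmeticKakeyaDistinct, ArithmeticKakeyaDim n,
        MinkowskiArithmeticKakeya n, PackingArithmeticKakeya n].TFAE) := by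
  have hex : ∀ k : ℕ, ∃ α : ℝ, 1 ≤ k →
      Tendsto (fun N : ℕ => Real.log (minCardAPInitial k N) / Real.log N) atTop (𝓝 α) := by
    intro k
    by_cases hk : 1 ≤ k
    · obtain ⟨α, hα⟩ := exists_tendsto_minCardAPInitial hk
      exact ⟨α, fun _ => hα⟩
    · exact ⟨0, fun h => absurd h hk⟩
  choose α hα using hex
  have hM : ∀ n k, 1 ≤ k → minkowskiAP n k = ((n * α k : ℝ) : EReal) := fun n k hk =>
    le_antisymm (minkowskiAP_le hk (hα k hk))
      ((le_packingAP hk (hα k hk)).trans (packingAP_le_minkowskiAP n k))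
  have hP : ∀ n k, 1 ≤ k → packingAP n k = ((n * α k : ℝ) : EReal) := fun n k hk =>
    le_antisymm ((packingAP_le_minkowskiAP n k).trans (hM n k hk).le) (le_packingAP hk (hα k hk))
  refine ⟨fun n k hn hk => ⟨n * α k, hP n k hk, hM n k hk, tendsto_minCardAPDim hn hk (hα k hk)⟩,
    fun k hk => ⟨α k, by simpa using hP 1 k hk, by simpa using hM 1 k hk,
      tendsto_minCardAPDistinct hk (hα k hk)⟩, fun n hn => ?_⟩
  have h1 : ArithmeticKakeyaInitial ↔ Tendsto α atTop (𝓝 1) := iteratedExponentLimit_iff hα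
  have h2 : ArithmeticKakeyaDistinct ↔ Tendsto α atTop (𝓝 1) :=
    iteratedExponentLimit_iff fun k hk => tendsto_minCardAPDistinct hk (hα k hk)
  have h3 : ArithmeticKakeyaDim n ↔ Tendsto α atTop (𝓝 1) :=
    (iteratedExponentLimit_iff fun k hk => tendsto_minCardAPDim hn hk (hα k hk)).trans
      (tendsto_natCast_mul_iff hn)
  have h4 : MinkowskiArithmeticKakeya n ↔ Tendsto α atTop (𝓝 1) := tendsto_ereal_iff hn (hM n)
  have h5 : PackingArithmeticKakeya n ↔ Tendsto α atTop (𝓝 1) := tendsto_ereal_iff hn (hP n)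
  tfae_have 1 ↔ 2 := h1.trans h2.symm
  tfae_have 2 ↔ 3 := h2.trans h3.symm
  tfae_have 3 ↔ 4 := h3.trans h4.symm
  tfae_have 4 ↔ 5 := h4.trans h5.symm
  tfae_finish
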